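/- Let $n\ge 1$ and let $M$ be a smooth $4n$-dimensional manifold with a quaternionic structure, that is, an $\mathrm{Sp}(1)\mathrm{GL}(n,\mathbb H)$-structure $Q$ (a smooth principal subbundle of the bundle of frames $\mathbb H^n\cong T_xM$ whose structure group is the group of maps $v\mapsto qvA$, $q\in\mathrm{Sp}(1)$, $A\in\mathrm{GL}(n,\mathbb H)$) which, if $n\ge 2$, admits a torsion-free connection. (For $n=1$ such a $Q$ is an oriented conformal structure, and no further condition is imposed; in particular self-dual conformal $4$-manifolds are included.) Through the frames in $Q$, the action of $\mathrm{Sp}(1)$ on $\mathbb H^n$ by left multiplication induces an action on $\Lambda^kT_x^*M\otimes\mathbb C$. For $r\in\mathbb Z$ let $E_{k,r}\subseteq\Lambda^kT^*M\otimes\mathbb C$ be the subbundle formed by the sum of all irreducible $\mathrm{Sp}(1)$-subrepresentations of highest weight $r$ (zero if there are none, e.g. if $r<0$); it does not depend on the choice of frames in $Q$. Then $\Lambda^kT^*M\otimes\mathbb C=\bigoplus_r E_{k,r}$. Let $\pi_{k,r}$ be the projection onto $E_{k,r}$, and on sections of $E_{k,r}$ define $$\mathcal D=\pi_{k+1,r+1}\circ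 d,\qquad \overline{\mathcal D}=\pi_{k+1,r-1}\circ d,$$ extended to all smooth complex-valued $k$-forms by linearity. Then $\mathcal D$ and $\overline{\mathcal D}$ are linear operators on smooth forms, which map real forms to real forms and satisfy $\mathcal D\,C^\infty(E_{k,r})\subseteq C^\infty(E_{k+1,r+1})$ and $\overline{\mathcal D}\,C^\infty(E_{k,r})\subseteq C^\infty(E_{k+1,r-1})$. On all smooth forms, $$d=\mathcal D+\overline{\mathcal D},\qquad \mathcal D^2=\mathcal D\overline{\mathcal D}+\overline{\mathcal D}\mathcal D=\overline{\mathcal D}^2=0 .$$ Thus the spaces $C^\infty(E_{k,r})$ with $\mathcal D$ and $\overline{\mathcal D}$ form a double complex. -/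

import Mathlib

open scoped Quaternion Manifold ContDiff Matrix

noncomputable section

namespace QuatDolbeault

/-! ### Exterior forms with complex values -/

/-- Complex-valued alternating `k`-forms on a real topological vector space: `Λᵏ V* ⊗ ℂ`. -/
abbrev AltForm (V : Type*) [AddCommGroup V] [Module ℝ V] [TopologicalSpace V] (k : ℕ) : Type _ :=
  V [⋀^Fin k]→L[ℝ] ℂ

/-- Pullback of `k`-forms along a linear map, as a `ℂ`-linear map. -/
def pullback {V W : Type*} [AddCommGroup V] [Module ℝ V] [TopologicalSpace V]
    [AddCommGroup W] [Module ℝ W] [TopologicalSpace W] (A : V →L[ℝ] W) (k : ℕ) :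
    AltForm W k →ₗ[ℂ] AltForm V k where
  toFun α := α.compContinuousLinearMap A
  map_add' _ _ := rfl
  map_smul' _ _ := rfl

/-! ### The model space `ℍⁿ` and the isotypic components of its exterior forms -/

/-- The space `ℍⁿ`. -/
abbrev HSpace (n : ℕ) : Type := Fin n → ℍ[ℝ]

/-- Left multiplication `v ↦ q v` on `ℍⁿ`. -/
def leftMul (n : ℕ) (q : ℍ[ℝ]) : HSpace n →L[ℝ] HSpace n :=
  ContinuousLinearMap.pi fun a =>
    (ContinuousLinearMap.mul ℝ ℍ[ℝ] q).comp (ContinuousLinearMap.proj a)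

theorem leftMul_apply (n : ℕ) (q : ℍ[ℝ]) (v : HSpace n) : leftMul n q v = fun a => q * v a := rfl

/-- The quaternion `i`. -/
def quatI : ℍ[ℝ] := ⟨0, 1, 0, 0⟩

/-- The quaternion `j`. -/
def quatJ : ℍ[ℝ] := ⟨0, 0, 1, 0⟩

/-- The quaternion `k`. -/
def quatK : ℍ[ℝ] := ⟨0, 0, 0, 1⟩

/-- The structures `I`, `J`, `K` on `ℍⁿ`: left multiplication by `i`, `j`, `k`. They satisfy
`I² = J² = K² = -1`, `IJ = K`, and span the Lie algebra `𝔰𝔭(1)` of the group `Sp(1)` of unit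
quaternions. -/
def modelI (n : ℕ) : HSpace n →L[ℝ] HSpace n := leftMul n quatI

/-- See `modelI`. -/
def modelJ (n : ℕ) : HSpace n →L[ℝ] HSpace n := leftMul n quatJ

/-- See `modelI`. -/
def modelK (n : ℕ) : HSpace n →L[ℝ] HSpace n := leftMul n quatK

/-- The action on `k`-forms induced by an endomorphism `A` of `V` (dual representation, extended by
the Leibniz rule): `(A·α)(v₁,…,vₖ) = - ∑ᵢ α(v₁,…,A vᵢ,…,vₖ)`. -/
def lieAct {V : Type*} [NormedAddCommGroup V] [NormedSpace ℝ V] (k : ℕ) (A : V →L[ℝ] V) :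
    AltForm V k →ₗ[ℂ] AltForm V k where
  toFun α := -(α.fderivCompContinuousLinearMap (ContinuousLinearMap.id ℝ V) A)
  map_add' α β := by
    ext v
    simp only [ContinuousAlternatingMap.neg_apply, ContinuousAlternatingMap.add_apply,
      ContinuousAlternatingMap.fderivCompContinuousLinearMap_apply, Finset.sum_add_distrib, neg_add]
  map_smul' c α := by
    ext v
    simp only [ContinuousAlternatingMap.neg_apply, ContinuousAlternatingMap.smul_apply,
      ContinuousAlternatingMap.fderivCompContinuousLinearMap_apply, RingHom.id_apply,
      Finset.smul_sum, smul_neg]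

theorem lieAct_apply {V : Type*} [NormedAddCommGroup V] [NormedSpace ℝ V] (k : ℕ)
    (A : V →L[ℝ] V) (α : AltForm V k) (v : Fin k → V) :
    lieAct k A α v = -∑ i, α (Function.update v i (A (v i))) := by
  simp only [lieAct, LinearMap.coe_mk, AddHom.coe_mk, ContinuousAlternatingMap.neg_apply,
    ContinuousAlternatingMap.fderivCompContinuousLinearMap_apply]
  congr 1
  refine Finset.sum_congr rfl fun i _ => congrArg α (funext fun j => ?_)
  by_cases h : j = i
  · subst h; simp
  · simp [h]

/-- A highest weight vector of weight `r` in `Λᵏ(ℍⁿ)* ⊗ ℂ`, for the Cartan subalgebra of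
`𝔰𝔩(2,ℂ) = 𝔰𝔭(1) ⊗ ℂ` spanned by `I`: the element `-iI` acts by `r` (so that the weights are
integers) and the raising operator `J - iK` acts by zero.
(Since `[I, J - iK] = 2i (J - iK)`, the latter raises weights by `2`.) -/
def IsHighestWeightVector (n k : ℕ) (r : ℤ) (α : AltForm (HSpace n) k) : Prop :=
  lieAct k (modelI n) α = (Complex.I * (r : ℂ)) • α ∧
    lieAct k (modelJ n) α - Complex.I • lieAct k (modelK n) α = 0

/-- A subspace is a subrepresentation for `Sp(1)` (equivalently for its Lie algebra `⟨I, J, K⟩`). -/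
def IsSubrep (n k : ℕ) (W : Submodule ℂ (AltForm (HSpace n) k)) : Prop :=
  ∀ α ∈ W, lieAct k (modelI n) α ∈ W ∧ lieAct k (modelJ n) α ∈ W ∧ lieAct k (modelK n) α ∈ W

/-- The part of `Λᵏ(ℍⁿ)* ⊗ ℂ` consisting of the `Sp(1)`-representations of highest weight `r`:
the subrepresentation generated by all highest weight vectors of weight `r`, that is, the sum of
all irreducible subrepresentations isomorphic to `V_r`. (It is zero if there are none, for
instance if `r < 0`.) -/
def modelE (n k : ℕ) (r : ℤ) : Submodule ℂ (AltForm (HSpace n) k) :=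
  sInf {W | IsSubrep n k W ∧ ∀ α, IsHighestWeightVector n k r α → α ∈ W}

/-! ### `Sp(1)GL(n,ℍ)`-structures on manifolds -/

/-- `g` belongs to the group `Sp(1)GL(n,ℍ)`: `g v = q v A` for a unit quaternion `q` and an
invertible quaternionic matrix `A`, elements of `ℍⁿ` being row vectors. -/
def MemSpGL (n : ℕ) (g : HSpace n ≃L[ℝ] HSpace n) : Prop :=
  ∃ (q : ℍ[ℝ]) (A : (Matrix (Fin n) (Fin n) ℍ[ℝ])ˣ), ‖q‖ = 1 ∧
    ∀ v, g v = leftMul n q (v ᵥ* (A : Matrix (Fin n) (Fin n) ℍ[ℝ]))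

/-- `T` belongs to the Lie algebra of `Sp(1)GL(n,ℍ)`: `T v = p v + v B` for an imaginary
quaternion `p` and a quaternionic matrix `B`. -/
def MemLieSpGL (n : ℕ) (T : HSpace n →L[ℝ] HSpace n) : Prop :=
  ∃ (p : ℍ[ℝ]) (B : Matrix (Fin n) (Fin n) ℍ[ℝ]), p.re = 0 ∧
    ∀ v, T v = leftMul n p v + v ᵥ* B

section Manifold

variable (n : ℕ) (M : Type*) [TopologicalSpace M]
  [ChartedSpace (EuclideanSpace ℝ (Fin (4 * n))) M]

/-- A (local) field of frames `s x : ℍⁿ ≃ T_x M` is smooth on `U`. -/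
def SmoothFrameOn {n : ℕ} {M : Type*} [TopologicalSpace M]
    [ChartedSpace (EuclideanSpace ℝ (Fin (4 * n))) M] [IsManifold (𝓡 (4 * n)) ∞ M]
    (s : ∀ x : M, HSpace n ≃L[ℝ] TangentSpace (𝓡 (4 * n)) x) (U : Set M) : Prop :=
  ∀ v : HSpace n, ContMDiffOn (𝓡 (4 * n)) (𝓡 (4 * n)).tangent ∞
    (fun x => (⟨x, s x v⟩ : TangentBundle (𝓡 (4 * n)) M)) U

/-- An `Sp(1)GL(n,ℍ)`-structure on a `4n`-manifold: a smooth principal subbundle `Q`, with this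
structure group, of the bundle of frames `ℍⁿ ≃ T_x M`. Each fibre is one orbit of the group, and
there are smooth local sections. -/
structure SpGLStructure [IsManifold (𝓡 (4 * n)) ∞ M] where
  /-- the fibre `Q_x` -/
  frames : ∀ x : M, Set (HSpace n ≃L[ℝ] TangentSpace (𝓡 (4 * n)) x)
  /-- each fibre is a single orbit of the structure group -/
  mem_frames_iff : ∀ x, ∀ u ∈ frames x, ∀ w, w ∈ frames x ↔ ∃ g, MemSpGL n g ∧ w = g.trans u
  /-- around every point there is a smooth local section -/
  exists_section : ∀ x₀ : M, ∃ U : Set M, IsOpen U ∧ x₀ ∈ U ∧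
    ∃ s : ∀ x : M, HSpace n ≃L[ℝ] TangentSpace (𝓡 (4 * n)) x,
      SmoothFrameOn s U ∧ ∀ x ∈ U, s x ∈ frames x

variable {n M}

/-- The linear connection `∇` on `TM` is (induced by) a connection on `Q`: in every smooth local
frame belonging to `Q`, the connection form takes values in the Lie algebra of the structure
group. -/
def SpGLStructure.IsCompatible [IsManifold (𝓡 (4 * n)) ∞ M] (Q : SpGLStructure n M)
    (cov : CovariantDerivative (𝓡 (4 * n)) (EuclideanSpace ℝ (Fin (4 * n)))
      (TangentSpace (𝓡 (4 * n)) : M → Type _)) : Prop :=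
  ∀ (U : Set M) (s : ∀ x : M, HSpace n ≃L[ℝ] TangentSpace (𝓡 (4 * n)) x), IsOpen U →
    SmoothFrameOn s U → (∀ x ∈ U, s x ∈ Q.frames x) →
      ∀ x ∈ U, ∀ X : TangentSpace (𝓡 (4 * n)) x, ∃ T : HSpace n →L[ℝ] HSpace n,
        MemLieSpGL n T ∧ ∀ v, cov (fun y => s y v) x X = s x (T v)

/-- `Q` admits a (smooth) torsion-free connection. -/
def SpGLStructure.AdmitsTorsionFreeConnection [IsManifold (𝓡 (4 * n)) ∞ M]
    (Q : SpGLStructure n M) : Prop :=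
  ∃ cov : CovariantDerivative (𝓡 (4 * n)) (EuclideanSpace ℝ (Fin (4 * n)))
      (TangentSpace (𝓡 (4 * n)) : M → Type _),
    CovariantDerivative.ContMDiffCovariantDerivative cov ∞ ∧ cov.torsion = 0 ∧ Q.IsCompatible cov

/-! ### Differential forms and the exterior derivative -/

variable (n M) in
/-- (Not necessarily smooth) complex-valued differential `k`-forms on `M`. -/
abbrev DForm (k : ℕ) : Type _ := ∀ x : M, AltForm (TangentSpace (𝓡 (4 * n)) x) k

/-- The expression of a form in the preferred chart `φ` at `x₀`, that is, the form `(φ⁻¹)^* η`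
(meaningful on the target of the chart). -/
def chartRep {k : ℕ} (η : DForm n M k) (x₀ : M) :
    EuclideanSpace ℝ (Fin (4 * n)) → AltForm (EuclideanSpace ℝ (Fin (4 * n))) k :=
  fun y => (η ((extChartAt (𝓡 (4 * n)) x₀).symm y)).compContinuousLinearMap
    (mfderiv 𝓘(ℝ, EuclideanSpace ℝ (Fin (4 * n))) (𝓡 (4 * n))
      (extChartAt (𝓡 (4 * n)) x₀).symm y)

/-- `η` is a smooth form. -/
def IsSmoothForm {k : ℕ} (η : DForm n M k) : Prop :=
  ∀ x₀ : M, ContDiffOn ℝ ∞ (chartRep η x₀) (extChartAt (𝓡 (4 * n)) x₀).target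

/-- `η` is real-valued. -/
def IsRealForm {k : ℕ} (η : DForm n M k) : Prop :=
  ∀ x v, (η x v).im = 0

/-- The exterior derivative, computed at `x` in the preferred chart `φ` at `x`:
`(dη)_x = φ^*(d((φ⁻¹)^* η))` at `x`. -/
def extD {k : ℕ} (η : DForm n M k) : DForm n M (k + 1) :=
  fun x => (extDeriv (chartRep η x) (extChartAt (𝓡 (4 * n)) x x)).compContinuousLinearMap
    (mfderiv (𝓡 (4 * n)) 𝓘(ℝ, EuclideanSpace ℝ (Fin (4 * n))) (extChartAt (𝓡 (4 * n)) x) x)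

/-! ### The bundles `E_{k,r}` and the operators `𝒟`, `𝒟̄` -/

variable [IsManifold (𝓡 (4 * n)) ∞ M] (Q : SpGLStructure n M)

/-- The fibre at `x` of `E_{k,r} ⊆ Λᵏ T^*M ⊗ ℂ`: the forms which a frame in `Q_x` identifies with
elements of `modelE n k r`. (The result is the same for every frame in `Q_x`.) -/
def SpGLStructure.E (k : ℕ) (r : ℤ) (x : M) :
    Submodule ℂ (AltForm (TangentSpace (𝓡 (4 * n)) x) k) :=
  ⨆ u ∈ Q.frames x,
    (modelE n k r).comap (pullback (u : HSpace n →L[ℝ] TangentSpace (𝓡 (4 * n)) x) k)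

/-- `C^∞(M, E_{k,r})`: `η` is a smooth section of `E_{k,r}`. -/
def SpGLStructure.IsSmoothSection (k : ℕ) (r : ℤ) (η : DForm n M k) : Prop :=
  IsSmoothForm η ∧ ∀ x, η x ∈ Q.E k r x

open Classical in
/-- The projection `π_{k,r}` of `Λᵏ T_x^*M ⊗ ℂ = ⨁ₛ E_{k,s}` onto `E_{k,r}`, along the sum of the
other summands. -/
def SpGLStructure.proj (k : ℕ) (r : ℤ) (x : M) :
    AltForm (TangentSpace (𝓡 (4 * n)) x) k →ₗ[ℂ] AltForm (TangentSpace (𝓡 (4 * n)) x) k :=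
  if h : IsCompl (Q.E k r x) (⨆ s ∈ {s : ℤ | s ≠ r}, Q.E k s x) then
    Submodule.projection _ _ h else 0

/-- `𝒟 = π_{k+1,r+1} ∘ d`, for sections of `E_{k,r}`. -/
def SpGLStructure.upper (k : ℕ) (r : ℤ) (η : DForm n M k) : DForm n M (k + 1) :=
  fun x => Q.proj (k + 1) (r + 1) x (extD η x)

/-- `𝒟̄ = π_{k+1,r-1} ∘ d`, for sections of `E_{k,r}`. -/
def SpGLStructure.lower (k : ℕ) (r : ℤ) (η : DForm n M k) : DForm n M (k + 1) :=
  fun x => Q.proj (k + 1) (r - 1) x (extD η x)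

/-- The operator `𝒟` on all `k`-forms: `𝒟 η = ∑_{r=0}^k 𝒟 (π_{k,r} η)`. -/
def SpGLStructure.D {k : ℕ} (η : DForm n M k) : DForm n M (k + 1) :=
  ∑ r ∈ Finset.range (k + 1), Q.upper k r fun x => Q.proj k r x (η x)

/-- The operator `𝒟̄` on all `k`-forms: `𝒟̄ η = ∑_{r=0}^k 𝒟̄ (π_{k,r} η)`. -/
def SpGLStructure.Dbar {k : ℕ} (η : DForm n M k) : DForm n M (k + 1) :=
  ∑ r ∈ Finset.range (k + 1), Q.lower k r fun x => Q.proj k r x (η x)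

end Manifold

end QuatDolbeault

end

/-!
The imaginary quaternions act on `Λᵏ(ℍⁿ)* ⊗ ℂ` by three operators satisfying the relations of
`𝔰𝔭(1)`, and `E_{k,r}` is the eigenspace of their Casimir operator for the eigenvalue `-r(r + 2)`.
Since `(ℍⁿ)* ⊗ ℂ` is a sum of representations of highest weight `1`, the Clebsch–Gordan rule puts
`α ∧ ε`, for `α` of type `r`, into the sum of the types `r + 1` and `r - 1`.

If `∇` is a torsion-free connection on the structure, then `d` is the alternation of `∇`. As `∇`
preserves `E_{k,r}`, it follows that `d` maps sections of `E_{k,r}` to sections of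
`E_{k+1,r+1} ⊕ E_{k+1,r-1}`. For `n = 1` no connection is needed: whenever `E_{k,r} ≠ 0`, these two
summands exhaust `Λ^{k+1}`. Hence `d = 𝒟 + 𝒟̄`, and the identities for `𝒟` and `𝒟̄` are the
components of `d² = 0` of weights `r + 2`, `r` and `r - 2`.
-/

noncomputable section

namespace QuatDolbeault

section Representations

/-- The commutation relations of the standard basis of `𝔰𝔭(1)`, the imaginary quaternions: these are
the relations between the *actions* of `i`, `j`, `k` on a representation, so that the quaternion
relations themselves (such as `I * I = -1`) are not imposed. -/
structure IsSpTriple {A : Type*} [Ring A] (I J K : A) : Prop where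
  mul_IJ : I * J = J * I + 2 • K
  mul_JK : J * K = K * J + 2 • I
  mul_KI : K * I = I * K + 2 • J

/-- The Casimir element of `𝔰𝔭(1)`, normalised so that it acts by `-r (r + 2)` on the irreducible
representation of highest weight `r`. -/
def casimir {A : Type*} [Ring A] (I J K : A) : A := I * I + J * J + K * K

section Ring

variable {A : Type*} [Ring A] {I J K : A}

theorem IsSpTriple.rotate (h : IsSpTriple I J K) : IsSpTriple J K I :=
  ⟨h.mul_JK, h.mul_KI, h.mul_IJ⟩

theorem IsSpTriple.neg_swap (h : IsSpTriple I J K) : IsSpTriple (-I) K J where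
  mul_IJ := by rw [neg_mul, mul_neg, h.mul_KI]; abel
  mul_JK := by rw [h.mul_JK]; abel
  mul_KI := by rw [neg_mul, mul_neg, h.mul_IJ]; abel

theorem casimir_rotate (I J K : A) : casimir J K I = casimir I J K := by
  simp only [casimir]; abel

theorem casimir_neg_swap (I J K : A) : casimir (-I) K J = casimir I J K := by
  simp only [casimir, neg_mul_neg]; abel

theorem IsSpTriple.commute_casimir (h : IsSpTriple I J K) : Commute (casimir I J K) I := by
  have hJJ : J * J * I = I * (J * J) - 2 • (K * J + J * K) := by
    have hJI : J * I = I * J - 2 • K := by rw [h.mul_IJ]; abel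
    rw [mul_assoc, hJI, mul_sub, ← mul_assoc, hJI]
    noncomm_ring
  have hKK : K * K * I = I * (K * K) + 2 • (K * J + J * K) := by
    rw [mul_assoc, h.mul_KI, mul_add, ← mul_assoc, h.mul_KI]
    noncomm_ring
  rw [commute_iff_eq, casimir, add_mul, add_mul, hJJ, hKK]
  noncomm_ring

end Ring

open Complex (I_sq)

local notation "𝕚" => Complex.I

variable {W : Type*} [AddCommGroup W] [Module ℂ W] {I J K : Module.End ℂ W}

/-- The space of vectors of weight `m` for the Cartan subalgebra of `𝔰𝔭(1) ⊗ ℂ = 𝔰𝔩(2, ℂ)` spanned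
by `I`, normalised as in `IsHighestWeightVector`. -/
def weightSpace (I : Module.End ℂ W) (m : ℤ) : Submodule ℂ W := I.eigenspace (𝕚 * (m : ℂ))

theorem mem_weightSpace {m : ℤ} {α : W} : α ∈ weightSpace I m ↔ I α = (𝕚 * (m : ℂ)) • α :=
  Module.End.mem_eigenspace_iff

theorem mem_weightSpace_neg {m : ℤ} {α : W} :
    α ∈ weightSpace (-I) (-m) ↔ α ∈ weightSpace I m := by
  simp only [mem_weightSpace, LinearMap.neg_apply, Int.cast_neg, mul_neg, neg_smul, neg_inj]

theorem eigenspace_eq_bot_of_iSup_weightSpace (hI : ⨆ m, weightSpace I m = ⊤) {μ : ℂ}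
    (hμ : μ ∉ Set.range fun m : ℤ => 𝕚 * (m : ℂ)) : I.eigenspace μ = ⊥ := by
  by_contra hne
  refine hμ (iSupIndep.mem_of_biSup_eq_top I.eigenspaces_iSupIndep ?_ hne)
  rwa [iSup_range]

/-- The raising operator of `𝔰𝔭(1) ⊗ ℂ = 𝔰𝔩(2, ℂ)` for the Cartan subalgebra spanned by `I`. The
lowering operator `J + iK` is `i • raising K J`, the raising operator of the triple `(-I, K, J)` up
to a scalar. -/
def raising (J K : Module.End ℂ W) : Module.End ℂ W := J - 𝕚 • K

theorem raising_apply (α : W) : raising J K α = J α - 𝕚 • K α := rfl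

/-- The eigenspace on which the Casimir operator acts as it does on the irreducible representation
of highest weight `r`. -/
def casimirEigenspace (I J K : Module.End ℂ W) (r : ℤ) : Submodule ℂ W :=
  (casimir I J K).eigenspace (-(r * (r + 2)) : ℂ)

theorem mem_casimirEigenspace {r : ℤ} {α : W} :
    α ∈ casimirEigenspace I J K r ↔ casimir I J K α = (-(r * (r + 2)) : ℂ) • α :=
  Module.End.mem_eigenspace_iff

namespace IsSpTriple

theorem apply_mem_casimirEigenspace (h : IsSpTriple I J K) {r : ℤ} {α : W}
    (hα : α ∈ casimirEigenspace I J K r) : I α ∈ casimirEigenspace I J K r := by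
  rw [mem_casimirEigenspace] at hα ⊢
  rw [← Module.End.mul_apply, h.commute_casimir.eq, Module.End.mul_apply, hα, map_smul]

theorem casimirEigenspace_invariant (h : IsSpTriple I J K) {r : ℤ} {α : W}
    (hα : α ∈ casimirEigenspace I J K r) : I α ∈ casimirEigenspace I J K r ∧
      J α ∈ casimirEigenspace I J K r ∧ K α ∈ casimirEigenspace I J K r := by
  refine ⟨h.apply_mem_casimirEigenspace hα, ?_, ?_⟩
  · rw [casimirEigenspace, ← casimir_rotate] at hα ⊢
    exact h.rotate.apply_mem_casimirEigenspace hα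
  · rw [casimirEigenspace, ← casimir_rotate, ← casimir_rotate] at hα ⊢
    exact h.rotate.rotate.apply_mem_casimirEigenspace hα

theorem raising_mem_casimirEigenspace (h : IsSpTriple I J K) {r : ℤ} {α : W}
    (hα : α ∈ casimirEigenspace I J K r) : raising J K α ∈ casimirEigenspace I J K r :=
  have hinv := h.casimirEigenspace_invariant hα
  sub_mem hinv.2.1 (Submodule.smul_mem _ _ hinv.2.2)

theorem raising_mem_weightSpace (h : IsSpTriple I J K) {α : W} {m : ℤ}
    (hα : α ∈ weightSpace I m) : raising J K α ∈ weightSpace I (m + 2) := by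
  rw [mem_weightSpace] at hα ⊢
  have hIJ : I (J α) = J (I α) + 2 • K α := LinearMap.congr_fun h.mul_IJ α
  have hIK : I (K α) = K (I α) - 2 • J α :=
    eq_sub_of_add_eq (LinearMap.congr_fun h.mul_KI α).symm
  rw [raising_apply, map_sub, map_smul, hIJ, hIK, hα, map_smul, map_smul]
  push_cast
  match_scalars <;> grind [I_sq]

theorem casimir_apply_of_mem_weightSpace (h : IsSpTriple I J K) {α : W} {m : ℤ}
    (hα : α ∈ weightSpace I m) :
    casimir I J K α = (-(m * (m + 2)) : ℂ) • α + 𝕚 • raising K J (raising J K α) := by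
  rw [mem_weightSpace] at hα
  have hJK : J (K α) = K (J α) + 2 • I α := LinearMap.congr_fun h.mul_JK α
  simp only [casimir, raising_apply, LinearMap.add_apply, Module.End.mul_apply, map_sub, map_smul,
    hJK, hα]
  match_scalars <;> grind [I_sq]

theorem sub_mul_add_eq_zero_of_highestWeight (h : IsSpTriple I J K) {r m : ℤ} {α : W}
    (hα : α ∈ weightSpace I m) (hα₀ : α ≠ 0) (hraise : raising J K α = 0)
    (hr : α ∈ casimirEigenspace I J K r) : (m - r) * (m + r + 2) = 0 := by
  have hcas := h.casimir_apply_of_mem_weightSpace hα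
  rw [hraise, map_zero, smul_zero, add_zero, mem_casimirEigenspace.mp hr] at hcas
  have hcoeff : (m * (m + 2) : ℂ) = r * (r + 2) :=
    neg_injective (smul_left_injective ℂ hα₀ hcas).symm
  have hcoeff' : m * (m + 2) = r * (r + 2) := by exact_mod_cast hcoeff
  linear_combination hcoeff'

attribute [local instance] LieRing.ofAssociativeRing in
theorem isSl2Triple (h : IsSpTriple I J K) (hI : I ≠ 0) :
    IsSl2Triple (-𝕚 • I) (raising J K) (-(1 / 4 : ℂ) • (J + 𝕚 • K)) where
  h_ne_zero := by simpa using hI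
  lie_e_f := by
    rw [Ring.lie_def, raising]
    simp only [mul_sub, sub_mul, mul_add, add_mul, smul_mul_assoc, mul_smul_comm, h.mul_JK]
    match_scalars <;> ring
  lie_h_e_nsmul := by
    rw [Ring.lie_def, raising]
    simp only [mul_sub, sub_mul, smul_mul_assoc, mul_smul_comm, h.mul_IJ, h.mul_KI]
    match_scalars <;> grind [I_sq]
  lie_h_f_nsmul := by
    rw [Ring.lie_def]
    simp only [mul_add, add_mul, smul_mul_assoc, mul_smul_comm, h.mul_IJ, h.mul_KI]
    match_scalars <;> grind [I_sq]

variable [FiniteDimensional ℂ W]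

attribute [local instance] LieRing.ofAssociativeRing in
theorem highestWeight_nonneg (h : IsSpTriple I J K) {α : W} {m : ℤ} (hα : α ∈ weightSpace I m)
    (hα₀ : α ≠ 0) (hraise : raising J K α = 0) : 0 ≤ m := by
  rw [mem_weightSpace] at hα
  by_cases hI : I = 0
  · rw [hI, LinearMap.zero_apply, eq_comm, smul_eq_zero_iff_left hα₀] at hα
    exact (by simpa using hα : m = 0).ge
  have hprim : (h.isSl2Triple hI).HasPrimitiveVectorWith α (m : ℂ) :=
    ⟨hα₀, by simp [hα, smul_smul, ← mul_assoc], hraise⟩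
  obtain ⟨l, hl⟩ := hprim.exists_nat
  exact (by exact_mod_cast hl : m = l) ▸ Int.natCast_nonneg l

theorem exists_raising_pow_eq_zero (h : IsSpTriple I J K) {α : W} {m : ℤ}
    (hα : α ∈ weightSpace I m) : ∃ j : ℕ, (raising J K ^ j) α = 0 := by
  by_contra! hne
  have hweight (j : ℕ) : (raising J K ^ j) α ∈ weightSpace I (m + 2 * j) := by
    induction j with
    | zero => simpa using hα
    | succ j ih =>
      rw [pow_succ', Module.End.mul_apply]
      exact (show m + 2 * j + 2 = m + 2 * (j + 1 : ℕ) by push_cast; ring) ▸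
        h.raising_mem_weightSpace ih
  have hli := I.eigenvectors_linearIndependent' (fun j : ℕ => 𝕚 * ((m + 2 * j : ℤ) : ℂ))
    (fun j j' hj => by simpa using hj) (fun j => (raising J K ^ j) α)
    (fun j => ⟨hweight j, hne j⟩)
  exact not_finite_iff_infinite.mpr inferInstance hli.finite

theorem raising_induction (h : IsSpTriple I J K) {motive : ℤ → W → Prop}
    (zero : ∀ m, motive m 0)
    (raise : ∀ m α, α ∈ weightSpace I m → motive (m + 2) (raising J K α) → motive m α)
    {α : W} {m : ℤ} (hα : α ∈ weightSpace I m) : motive m α := by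
  obtain ⟨j, hj⟩ := h.exists_raising_pow_eq_zero hα
  induction j generalizing α m with
  | zero => exact (show α = 0 from hj) ▸ zero m
  | succ j ih =>
    rw [pow_succ, Module.End.mul_apply] at hj
    exact raise m α hα (ih (h.raising_mem_weightSpace hα) hj)

theorem weight_le (h : IsSpTriple I J K) {r : ℤ} (hr : -1 ≤ r) {α : W} {m : ℤ}
    (hα : α ∈ weightSpace I m) (hαr : α ∈ casimirEigenspace I J K r) (hα₀ : α ≠ 0) : m ≤ r := by
  refine h.raising_induction (motive := fun m α => α ∈ casimirEigenspace I J K r → α ≠ 0 → m ≤ r)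
    (fun m _ h0 => absurd rfl h0) (fun m α hα ih hαr hα₀ => ?_) hα hαr hα₀
  by_cases hraise : raising J K α = 0
  · have hm := h.highestWeight_nonneg hα hα₀ hraise
    rcases mul_eq_zero.mp (h.sub_mul_add_eq_zero_of_highestWeight hα hα₀ hraise hαr) <;> lia
  · linarith [ih (h.raising_mem_casimirEigenspace hαr) hraise]

theorem neg_le_weight (h : IsSpTriple I J K) {r : ℤ} (hr : -1 ≤ r) {α : W} {m : ℤ}
    (hα : α ∈ weightSpace I m) (hαr : α ∈ casimirEigenspace I J K r) (hα₀ : α ≠ 0) : -r ≤ m := by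
  rw [casimirEigenspace, ← casimir_neg_swap] at hαr
  exact neg_le.mp (h.neg_swap.weight_le hr (mem_weightSpace_neg.mpr hα) hαr hα₀)

end IsSpTriple

/-- The subrepresentation generated by the highest weight vectors of weight `r`, that is, the sum of
all irreducible subrepresentations of highest weight `r`; compare `modelE`. -/
def isotypic (I J K : Module.End ℂ W) (r : ℤ) : Submodule ℂ W :=
  sInf {U | (∀ α ∈ U, I α ∈ U ∧ J α ∈ U ∧ K α ∈ U) ∧
    ∀ α, (I α = (𝕚 * (r : ℂ)) • α ∧ J α - 𝕚 • K α = 0) → α ∈ U}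

theorem mem_isotypic_of_highestWeight {r : ℤ} {α : W} (hα : α ∈ weightSpace I r)
    (hraise : raising J K α = 0) : α ∈ isotypic I J K r :=
  Submodule.mem_sInf.mpr fun _ hU => hU.2 α ⟨mem_weightSpace.mp hα, hraise⟩

theorem isotypic_le {r : ℤ} {U : Submodule ℂ W} (hU : ∀ α ∈ U, I α ∈ U ∧ J α ∈ U ∧ K α ∈ U)
    (hw : ∀ α ∈ weightSpace I r, raising J K α = 0 → α ∈ U) : isotypic I J K r ≤ U :=
  sInf_le ⟨hU, fun α hα => hw α (mem_weightSpace.mpr hα.1) hα.2⟩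

theorem isotypic_invariant {r : ℤ} {α : W} (hα : α ∈ isotypic I J K r) :
    I α ∈ isotypic I J K r ∧ J α ∈ isotypic I J K r ∧ K α ∈ isotypic I J K r := by
  simp only [isotypic, Submodule.mem_sInf] at hα ⊢
  exact ⟨fun U hU => (hU.1 α (hα U hU)).1, fun U hU => (hU.1 α (hα U hU)).2.1,
    fun U hU => (hU.1 α (hα U hU)).2.2⟩

namespace IsSpTriple

theorem isotypic_le_casimirEigenspace (h : IsSpTriple I J K) (r : ℤ) :
    isotypic I J K r ≤ casimirEigenspace I J K r := by
  refine isotypic_le (fun α => h.casimirEigenspace_invariant) fun α hα hraise => ?_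
  rw [mem_casimirEigenspace, h.casimir_apply_of_mem_weightSpace hα, hraise, map_zero, smul_zero,
    add_zero]

variable [FiniteDimensional ℂ W]

theorem isotypic_of_neg (h : IsSpTriple I J K) {r : ℤ} (hr : r < 0) : isotypic I J K r = ⊥ := by
  refine eq_bot_iff.mpr (isotypic_le (fun α hα => ?_) fun α hα hraise => ?_)
  · simp [(Submodule.mem_bot ℂ).mp hα]
  · by_contra hα₀
    exact hr.not_ge (h.highestWeight_nonneg hα hα₀ hraise)

/-- Lowering `raising J K α` gives back a multiple of `α` modulo the Casimir relation, and the
coefficient vanishes only when `α` is itself a highest weight vector. -/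
theorem mem_isotypic_of_mem_weightSpace (h : IsSpTriple I J K) {r : ℤ} (hr : -1 ≤ r) {α : W}
    {m : ℤ} (hα : α ∈ weightSpace I m) (hαr : α ∈ casimirEigenspace I J K r) :
    α ∈ isotypic I J K r := by
  refine h.raising_induction
    (motive := fun _ α => α ∈ casimirEigenspace I J K r → α ∈ isotypic I J K r)
    (fun _ _ => zero_mem _) (fun m α hα ih hαr => ?_) hα hαr
  obtain rfl | hα₀ := eq_or_ne α 0
  · exact zero_mem _
  have hlower : -r ≤ m := h.neg_le_weight hr hα hαr hα₀
  by_cases hraise : raising J K α = 0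
  · obtain rfl : m = r := by
      rcases mul_eq_zero.mp (h.sub_mul_add_eq_zero_of_highestWeight hα hα₀ hraise hαr) <;> lia
    exact mem_isotypic_of_highestWeight hα hraise
  have hupper : m + 2 ≤ r := h.weight_le hr (h.raising_mem_weightSpace hα)
    (h.raising_mem_casimirEigenspace hαr) hraise
  have hmul : ((m - r) * (m + r + 2) : ℂ) • α ∈ isotypic I J K r := by
    have hinv := isotypic_invariant (ih (h.raising_mem_casimirEigenspace hαr))
    have hback := Submodule.smul_mem _ 𝕚 (sub_mem hinv.2.2 (Submodule.smul_mem _ 𝕚 hinv.2.1))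
    rw [← raising_apply, ← sub_eq_of_eq_add' (h.casimir_apply_of_mem_weightSpace hα),
      mem_casimirEigenspace.mp hαr, ← sub_smul] at hback
    convert hback using 2
    ring
  have hne : (m - r) * (m + r + 2) ≠ 0 := mul_ne_zero (by lia) (by lia)
  exact (Submodule.smul_mem_iff _ (by exact_mod_cast hne)).mp hmul

theorem isotypic_eq_casimirEigenspace (h : IsSpTriple I J K) (hI : ⨆ m, weightSpace I m = ⊤) {r : ℤ}
    (hr : -1 ≤ r) : isotypic I J K r = casimirEigenspace I J K r := by
  refine le_antisymm (h.isotypic_le_casimirEigenspace r) ?_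
  have htop : ⨆ μ : ℂ, I.eigenspace μ = ⊤ :=
    top_le_iff.mp (hI ▸ iSup_le fun m => le_iSup I.eigenspace (𝕚 * (m : ℂ)))
  rw [Submodule.eq_iSup_inf_genEigenspace 1 (fun α => h.apply_mem_casimirEigenspace (r := r)) htop]
  refine iSup_le fun μ => ?_
  by_cases hμ : μ ∈ Set.range fun m : ℤ => 𝕚 * (m : ℂ)
  · obtain ⟨m, rfl⟩ := hμ
    exact fun α hα => h.mem_isotypic_of_mem_weightSpace hr hα.2 hα.1
  · exact inf_le_right.trans ((eigenspace_eq_bot_of_iSup_weightSpace hI hμ).le.trans bot_le)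

end IsSpTriple

end Representations

section ClebschGordan

theorem mem_eigenspace_sup_eigenspace {F W : Type*} [Field F] [AddCommGroup W] [Module F W]
    {f : Module.End F W} {a b : F} (hab : a ≠ b) {x : W}
    (h : f (f x) = (a + b) • f x - (a * b) • x) : x ∈ f.eigenspace a ⊔ f.eigenspace b := by
  have hcoprime : IsCoprime (Polynomial.X - Polynomial.C a) (Polynomial.X - Polynomial.C b) :=
    Polynomial.isCoprime_X_sub_C_of_isUnit_sub (sub_ne_zero.mpr hab).isUnit
  have hker := Polynomial.sup_ker_aeval_eq_ker_aeval_mul_of_coprime f hcoprime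
  simp only [map_mul, map_sub, Polynomial.aeval_X, Polynomial.aeval_C,
    Algebra.algebraMap_eq_smul_one, ← Module.End.eigenspace_def] at hker
  rw [hker, LinearMap.mem_ker]
  simp only [Module.End.mul_apply, LinearMap.sub_apply, LinearMap.smul_apply, Module.End.one_apply,
    map_sub, map_smul, h]
  module

open scoped TensorProduct

variable {U W : Type*} [AddCommGroup U] [Module ℂ U] [AddCommGroup W] [Module ℂ W]

/-- The tensor product of two Lie algebra actions, `X` acting on `U` and `Y` on `W`. -/
def tensorAct (X : Module.End ℂ U) (Y : Module.End ℂ W) : Module.End ℂ (U ⊗[ℂ] W) :=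
  X.rTensor W + Y.lTensor U

@[simp]
theorem tensorAct_tmul (X : Module.End ℂ U) (Y : Module.End ℂ W) (u : U) (w : W) :
    tensorAct X Y (u ⊗ₜ w) = X u ⊗ₜ w + u ⊗ₜ Y w := rfl

variable (q : QuaternionAlgebra.Basis (Module.End ℂ U) (-1 : ℂ) 0 (-1)) {I J K : Module.End ℂ W}

/-- The coupling `i ⊗ I + j ⊗ J + k ⊗ K` between a quaternionic action on `U` and an action of
`𝔰𝔭(1)` on `W`. For irreducible `W`, its eigenspaces are the isotypic components of `U ⊗ W`. -/
def coupling (I J K : Module.End ℂ W) : Module.End ℂ (U ⊗[ℂ] W) :=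
  TensorProduct.map q.i I + TensorProduct.map q.j J + TensorProduct.map q.k K

theorem IsSpTriple.coupling_mul_self (h : IsSpTriple I J K) :
    coupling q I J K * coupling q I J K =
      2 • coupling q I J K - (casimir I J K).lTensor U := by
  simp only [coupling, casimir, mul_add, add_mul, ← TensorProduct.map_mul, q.i_mul_i, q.j_mul_j,
    q.k_mul_k, q.i_mul_j, q.j_mul_i, q.i_mul_k, q.k_mul_i, q.j_mul_k, q.k_mul_j, h.mul_IJ, h.mul_JK,
    h.mul_KI]
  refine TensorProduct.ext' fun u w => ?_
  simp only [neg_smul, one_smul, zero_smul, add_zero, zero_sub, neg_neg, nsmul_eq_mul,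
    Nat.cast_ofNat, mul_neg, mul_one, neg_zero, sub_neg_eq_add, zero_add, LinearMap.add_apply,
    TensorProduct.map_tmul, LinearMap.neg_apply, Module.End.one_apply, Module.End.mul_apply,
    TensorProduct.neg_tmul, Module.End.ofNat_apply, TensorProduct.tmul_add, TensorProduct.tmul_smul,
    smul_add, LinearMap.lTensor_add, LinearMap.sub_apply, LinearMap.lTensor_tmul]
  module

theorem casimir_tensorAct :
    casimir (tensorAct q.i I) (tensorAct q.j J) (tensorAct q.k K) =
      (casimir I J K).lTensor U + 2 • coupling q I J K - 3 := by
  have hmul (X : Module.End ℂ U) (Y : Module.End ℂ W) :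
      tensorAct X Y * tensorAct X Y =
        (X * X).rTensor W + 2 • TensorProduct.map X Y + (Y * Y).lTensor U := by
    refine TensorProduct.ext' fun u w => ?_
    simp only [tensorAct, Module.End.mul_apply, LinearMap.add_apply, LinearMap.rTensor_tmul,
      LinearMap.lTensor_tmul, map_add, nsmul_eq_mul, Nat.cast_ofNat, TensorProduct.map_tmul,
      Module.End.ofNat_apply]
    module
  simp only [casimir, coupling, hmul, q.i_mul_i, q.j_mul_j, q.k_mul_k]
  refine TensorProduct.ext' fun u w => ?_
  simp only [neg_smul, one_smul, zero_smul, add_zero, LinearMap.rTensor_neg, nsmul_eq_mul,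
    Nat.cast_ofNat, mul_neg, mul_one, neg_neg, LinearMap.add_apply, LinearMap.neg_apply,
    LinearMap.rTensor_tmul, Module.End.one_apply, Module.End.mul_apply, TensorProduct.map_tmul,
    Module.End.ofNat_apply, LinearMap.lTensor_tmul, LinearMap.lTensor_add, smul_add,
    LinearMap.sub_apply]
  module

/-- On `U ⊗ W`, the coupling has the eigenvalues `r + 2` and `-r`, and the Casimir operator is
`-(Ω - 1)(Ω - 3)` in terms of the coupling `Ω`. -/
theorem IsSpTriple.tmul_mem_casimirEigenspace (h : IsSpTriple I J K) {r : ℤ} (hr : r ≠ -1) (u : U)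
    {w : W} (hw : w ∈ casimirEigenspace I J K r) :
    u ⊗ₜ w ∈ casimirEigenspace (tensorAct q.i I) (tensorAct q.j J) (tensorAct q.k K) (r + 1) ⊔
      casimirEigenspace (tensorAct q.i I) (tensorAct q.j J) (tensorAct q.k K) (r - 1) := by
  set Ω := coupling q I J K with hΩ
  have hcas : (casimir I J K).lTensor U = 2 • Ω - Ω * Ω := by
    rw [hΩ, h.coupling_mul_self, sub_sub_cancel]
  have heigen {c : ℂ} {s : ℤ} (hs : (c - 1) * (c - 3) = s * (s + 2)) :
      Ω.eigenspace c ≤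
        casimirEigenspace (tensorAct q.i I) (tensorAct q.j J) (tensorAct q.k K) s := by
    intro t ht
    rw [Module.End.mem_eigenspace_iff] at ht
    rw [mem_casimirEigenspace, casimir_tensorAct, ← hΩ, hcas, ← hs]
    simp only [LinearMap.sub_apply, LinearMap.add_apply, LinearMap.smul_apply, Module.End.mul_apply,
      Module.End.ofNat_apply, ht, map_smul]
    module
  have hsplit : u ⊗ₜ w ∈ Ω.eigenspace ((-r : ℤ) : ℂ) ⊔ Ω.eigenspace ((r + 2 : ℤ) : ℂ) := by
    refine mem_eigenspace_sup_eigenspace (by norm_cast; lia) ?_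
    rw [← Module.End.mul_apply, h.coupling_mul_self, LinearMap.sub_apply, LinearMap.lTensor_tmul,
      mem_casimirEigenspace.mp hw]
    rw [LinearMap.smul_apply, TensorProduct.tmul_smul]
    push_cast
    module
  refine sup_le_sup (heigen ?_) (heigen ?_) hsplit <;> push_cast <;> ring

end ClebschGordan

section Wedge

variable {V : Type*} [NormedAddCommGroup V] [NormedSpace ℝ V]
  {k : ℕ}

instance finiteDimensional_altForm [FiniteDimensional ℝ V] (k : ℕ) :
    FiniteDimensional ℂ (AltForm V k) := by
  let f : AltForm V k →ₗ[ℝ] MultilinearMap ℝ (fun _ : Fin k => V) ℂ :=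
    { toFun := fun α => α.toMultilinearMap
      map_add' := fun _ _ => rfl
      map_smul' := fun _ _ => rfl }
  have hf : Function.Injective f := fun α β h => by
    ext v
    exact congrArg (fun m : MultilinearMap ℝ (fun _ : Fin k => V) ℂ => m v) h
  have : FiniteDimensional ℝ (AltForm V k) := FiniteDimensional.of_injective f hf
  exact FiniteDimensional.right ℝ ℂ _

open ContinuousAlternatingMap (alternatizeUncurryFin alternatizeUncurryFin_apply
  alternatizeUncurryFin_add alternatizeUncurryFin_smul alternatizeUncurryFinCLM_apply curryLeft
  alternatizeUncurryFin_curryLeft)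

/-- Complex-valued covectors: `V* ⊗ ℂ`. -/
abbrev Covector (V : Type*) [AddCommGroup V] [Module ℝ V] [TopologicalSpace V] : Type _ := V →L[ℝ] ℂ

/-- The exterior product of a covector and a `k`-form. -/
def wedge : Covector V →ₗ[ℂ] AltForm V k →ₗ[ℂ] AltForm V (k + 1) :=
  LinearMap.mk₂ ℂ (fun f w => alternatizeUncurryFin (f.smulRight w))
    (fun f g w => by rw [← alternatizeUncurryFin_add]; congr 1; ext; simp [add_mul])
    (fun c f w => by rw [← alternatizeUncurryFin_smul]; congr 1; ext; simp [mul_assoc])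
    (fun f w w' => by rw [← alternatizeUncurryFin_add]; congr 1; ext; simp)
    (fun c f w => by rw [← alternatizeUncurryFin_smul]; congr 1; ext; simp [mul_left_comm])

theorem wedge_apply (f : Covector V) (w : AltForm V k) (v : Fin (k + 1) → V) :
    wedge f w v = ∑ i : Fin (k + 1), (-1) ^ (i : ℕ) * (f (v i) * w (i.removeNth v)) := by
  simp [wedge, alternatizeUncurryFin_apply]

/-- The action of an endomorphism on `V* ⊗ ℂ` dual to its action on `V`. -/
def covectorAct (A : V →L[ℝ] V) : Module.End ℂ (Covector V) where
  toFun f := -f.comp A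
  map_add' f g := by ext; simp [add_comm]
  map_smul' c f := by ext; simp

theorem covectorAct_apply (A : V →L[ℝ] V) (f : Covector V) (v : V) :
    covectorAct A f v = -f (A v) := rfl

theorem lieAct_wedge (A : V →L[ℝ] V) (f : Covector V) (w : AltForm V k) :
    lieAct (k + 1) A (wedge f w) = wedge (covectorAct A f) w + wedge f (lieAct k A w) := by
  ext v
  have hrest (i : Fin (k + 1)) (j : Fin k) :
      f (Function.update v (i.succAbove j) (A (v (i.succAbove j))) i) *
        w (i.removeNth (Function.update v (i.succAbove j) (A (v (i.succAbove j))))) =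
      f (v i) * w (Function.update (i.removeNth v) j (A (i.removeNth v j))) := by
    rw [Function.update_of_ne (Fin.succAbove_ne i j).symm, Fin.removeNth_update_succAbove]
    rfl
  simp only [lieAct_apply, ContinuousAlternatingMap.add_apply, wedge_apply]
  rw [Finset.sum_comm, ← Finset.sum_neg_distrib, ← Finset.sum_add_distrib]
  refine Finset.sum_congr rfl fun i _ => ?_
  simp only [Fin.sum_univ_succAbove _ i, hrest, Function.update_self, Fin.removeNth_update,
    covectorAct_apply, ← Finset.mul_sum]
  ring

theorem lieAct_zero_left (A : V →L[ℝ] V) : lieAct 0 A = 0 := by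
  ext α v
  simp [lieAct_apply]

variable [FiniteDimensional ℝ V]

theorem alternatizeUncurryFin_eq_sum_wedge {ι : Type*} [Fintype ι] (b : Module.Basis ι ℝ V)
    (β : V →L[ℝ] AltForm V k) : alternatizeUncurryFin β =
      ∑ j, wedge (Complex.ofRealCLM.comp (b.coord j).toContinuousLinearMap) (β (b j)) := by
  have hβ : β = ∑ j,
      (Complex.ofRealCLM.comp (b.coord j).toContinuousLinearMap).smulRight (β (b j)) := by
    ext1 v
    conv_lhs => rw [← b.sum_repr v]
    simp [_root_.map_sum, -Module.Basis.sum_repr]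
  conv_lhs => rw [hβ]
  simp only [← alternatizeUncurryFinCLM_apply, _root_.map_sum]
  rfl

theorem map₂_wedge_top : Submodule.map₂ (wedge (V := V) (k := k)) ⊤ ⊤ = ⊤ := by
  refine top_le_iff.mp fun α _ => ?_
  have hsum : (k + 1) • α ∈ Submodule.map₂ (wedge (V := V) (k := k)) ⊤ ⊤ := by
    rw [← alternatizeUncurryFin_curryLeft,
      alternatizeUncurryFin_eq_sum_wedge (Module.finBasis ℝ V)]
    exact sum_mem fun j _ => Submodule.apply_mem_map₂ _ Submodule.mem_top Submodule.mem_top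
  rw [← Nat.cast_smul_eq_nsmul ℂ] at hsum
  exact (Submodule.smul_mem_iff _ (Nat.cast_ne_zero.mpr k.succ_ne_zero)).mp hsum

theorem linearMap_ext_wedge {W : Type*} [AddCommGroup W] [Module ℂ W]
    {f g : AltForm V (k + 1) →ₗ[ℂ] W} (h : ∀ u w, f (wedge u w) = g (wedge u w)) : f = g := by
  have hle : Submodule.map₂ (wedge (V := V) (k := k)) ⊤ ⊤ ≤ LinearMap.eqLocus f g :=
    Submodule.map₂_le.mpr fun u _ w _ => h u w
  rw [map₂_wedge_top] at hle
  exact LinearMap.ext fun α => hle Submodule.mem_top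

end Wedge

section LieAction

variable {V : Type*} [NormedAddCommGroup V] [NormedSpace ℝ V] {k : ℕ}

/-- `lieAct k A` as a real linear function of the endomorphism `A`. -/
def lieActHom (V : Type*) [NormedAddCommGroup V] [NormedSpace ℝ V] (k : ℕ) :
    (V →L[ℝ] V) →ₗ[ℝ] Module.End ℂ (AltForm V k) where
  toFun := lieAct k
  map_add' A B := by ext α v; simp [lieAct, add_comm]
  map_smul' c A := by ext α v; simp [lieAct]

theorem covectorAct_mul (A B : V →L[ℝ] V) :
    covectorAct A * covectorAct B = -covectorAct (B * A) := by
  ext f v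
  simp [covectorAct_apply]

theorem covectorAct_commutator (A B : V →L[ℝ] V) :
    covectorAct A * covectorAct B - covectorAct B * covectorAct A =
      covectorAct (A * B - B * A) := by
  ext f v
  simp [covectorAct_mul, covectorAct_apply, sub_eq_add_neg]

theorem wedge_mem_weightSpace {A : V →L[ℝ] V} {l m : ℤ} {f : Covector V} {w : AltForm V k}
    (hf : f ∈ weightSpace (covectorAct A) l) (hw : w ∈ weightSpace (lieAct k A) m) :
    wedge f w ∈ weightSpace (lieAct (k + 1) A) (l + m) := by
  rw [mem_weightSpace] at hf hw ⊢
  rw [lieAct_wedge, hf, hw, map_smul, map_smul, LinearMap.smul_apply, ← add_smul]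
  push_cast
  ring_nf

theorem weightSpace_covectorAct_sup_eq_top {A : V →L[ℝ] V} (hA : A * A = -1) :
    weightSpace (covectorAct A) 1 ⊔ weightSpace (covectorAct A) (-1) = ⊤ := by
  refine top_le_iff.mp fun f _ => mem_eigenspace_sup_eigenspace ?_ ?_
  · simp [eq_neg_iff_add_eq_zero]
  · rw [← Module.End.mul_apply, covectorAct_mul, hA]
    ext v
    simp [covectorAct_apply]

variable [FiniteDimensional ℝ V]

theorem lieAct_mul_lieAct (k : ℕ) (A B : V →L[ℝ] V) :
    lieAct k A * lieAct k B = lieAct k B * lieAct k A + lieAct k (A * B - B * A) := by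
  induction k with
  | zero => simp [lieAct_zero_left]
  | succ k ih =>
    refine linearMap_ext_wedge fun f w => ?_
    have ih' : lieAct k A (lieAct k B w) = lieAct k B (lieAct k A w) + lieAct k (A * B - B * A) w :=
      LinearMap.congr_fun ih w
    simp only [LinearMap.add_apply, Module.End.mul_apply, lieAct_wedge, map_add, ih',
      ← covectorAct_commutator, LinearMap.sub_apply, map_sub]
    abel

theorem IsSpTriple.map_lieAct {A B C : V →L[ℝ] V} (h : IsSpTriple A B C) (k : ℕ) :
    IsSpTriple (lieAct k A) (lieAct k B) (lieAct k C) := by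
  have htwo (A : V →L[ℝ] V) : lieAct k (2 • A) = 2 • lieAct k A :=
    map_nsmul (lieActHom V k) 2 A
  constructor
  · rw [lieAct_mul_lieAct, h.mul_IJ, add_sub_cancel_left, htwo]
  · rw [lieAct_mul_lieAct, h.mul_JK, add_sub_cancel_left, htwo]
  · rw [lieAct_mul_lieAct, h.mul_KI, add_sub_cancel_left, htwo]

theorem iSup_weightSpace_lieAct {A : V →L[ℝ] V} (hA : A * A = -1) (k : ℕ) :
    ⨆ m, weightSpace (lieAct k A) m = ⊤ := by
  induction k with
  | zero =>
    refine top_le_iff.mp (le_iSup_of_le 0 fun α _ => ?_)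
    simp [mem_weightSpace, lieAct_zero_left]
  | succ k ih =>
    rw [← top_le_iff, ← map₂_wedge_top, ← ih, ← weightSpace_covectorAct_sup_eq_top hA,
      Submodule.map₂_iSup_right]
    refine iSup_le fun m => ?_
    rw [Submodule.map₂_sup_left]
    have hle (l : ℤ) : Submodule.map₂ wedge (weightSpace (covectorAct A) l)
        (weightSpace (lieAct k A) m) ≤ ⨆ m, weightSpace (lieAct (k + 1) A) m :=
      Submodule.map₂_le.mpr fun f hf w hw =>
        Submodule.mem_iSup_of_mem (l + m) (wedge_mem_weightSpace hf hw)
    exact sup_le (hle 1) (hle (-1))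

end LieAction

section Model

theorem isSpTriple_of_basis {A : Type*} [Ring A] [Algebra ℝ A]
    (q : QuaternionAlgebra.Basis A (-1 : ℝ) 0 (-1)) : IsSpTriple q.i q.j q.k where
  mul_IJ := by simp only [q.i_mul_j, q.j_mul_i]; module
  mul_JK := by simp only [q.j_mul_k, q.k_mul_j]; module
  mul_KI := by simp only [q.k_mul_i, q.i_mul_k]; module

variable (n k : ℕ)

/-- Left multiplication by quaternions, as a homomorphism of algebras. -/
def leftMulHom : ℍ[ℝ] →ₐ[ℝ] (HSpace n →L[ℝ] HSpace n) :=
  AlgHom.ofLinearMap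
    { toFun := leftMul n
      map_add' := fun p q => by ext1 v; funext a; simp [leftMul_apply, add_mul]
      map_smul' := fun c q => by ext1 v; funext a; simp [leftMul_apply] }
    (by ext1 v; funext a; simp [leftMul_apply])
    (fun p q => by ext1 v; funext a; simp [leftMul_apply, mul_assoc])

/-- The structures `modelI`, `modelJ`, `modelK` with their multiplication table. -/
def modelBasis : QuaternionAlgebra.Basis (HSpace n →L[ℝ] HSpace n) (-1 : ℝ) 0 (-1) :=
  (QuaternionAlgebra.Basis.self ℝ).compHom (leftMulHom n)

theorem modelI_mul_self : modelI n * modelI n = -1 :=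
  (modelBasis n).i_mul_i.trans (by simp)

/-- The quaternionic structure of the covectors of `ℍⁿ`. -/
def covectorBasis :
    QuaternionAlgebra.Basis (Module.End ℂ (Covector (HSpace n))) (-1 : ℂ) 0 (-1) where
  i := covectorAct (modelI n)
  j := covectorAct (modelJ n)
  k := covectorAct (modelK n)
  i_mul_i := by
    rw [covectorAct_mul, modelI_mul_self]
    ext; simp [covectorAct_apply]
  j_mul_j := by
    have h : modelJ n * modelJ n = -1 := (modelBasis n).j_mul_j.trans (by simp)
    rw [covectorAct_mul, h]
    ext; simp [covectorAct_apply]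
  i_mul_j := by
    have h : modelJ n * modelI n = -modelK n :=
      (modelBasis n).j_mul_i.trans (by rw [zero_smul, zero_sub]; rfl)
    rw [covectorAct_mul, h]
    ext; simp [covectorAct_apply]
  j_mul_i := by
    have h : modelI n * modelJ n = modelK n := (modelBasis n).i_mul_j
    rw [covectorAct_mul, h, zero_smul]
    ext; simp [covectorAct_apply]

theorem isSpTriple_lieAct :
    IsSpTriple (lieAct k (modelI n)) (lieAct k (modelJ n)) (lieAct k (modelK n)) :=
  (isSpTriple_of_basis (modelBasis n)).map_lieAct k

/-- The eigenspace of the Casimir operator of `Sp(1)` on `k`-forms which contains `modelE n k r`. It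
also makes sense, and is equal to `modelE n k r = ⊥`, for `r = -1`. -/
def modelCasimirEigenspace (r : ℤ) : Submodule ℂ (AltForm (HSpace n) k) :=
  casimirEigenspace (lieAct k (modelI n)) (lieAct k (modelJ n)) (lieAct k (modelK n)) r

variable {r : ℤ}

theorem modelE_eq_modelCasimirEigenspace (hr : -1 ≤ r) :
    modelE n k r = modelCasimirEigenspace n k r :=
  (isSpTriple_lieAct n k).isotypic_eq_casimirEigenspace
    (iSup_weightSpace_lieAct (modelI_mul_self n) k) hr

theorem modelE_of_neg (hr : r < 0) : modelE n k r = ⊥ := (isSpTriple_lieAct n k).isotypic_of_neg hr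

end Model

section Isotypic

open scoped TensorProduct

variable (n k : ℕ)

theorem lieAct_lift_wedge {V : Type*} [NormedAddCommGroup V] [NormedSpace ℝ V] {k : ℕ}
    (A : V →L[ℝ] V) (t : Covector V ⊗[ℂ] AltForm V k) :
    lieAct (k + 1) A (TensorProduct.lift wedge t) =
      TensorProduct.lift wedge (tensorAct (covectorAct A) (lieAct k A) t) := by
  induction t with
  | zero => simp only [map_zero]
  | tmul f w => simp only [TensorProduct.lift.tmul, tensorAct_tmul, map_add, lieAct_wedge]
  | add s t hs ht => simp only [map_add, hs, ht]

theorem lift_wedge_mem_modelCasimirEigenspace {k : ℕ} {r : ℤ}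
    {t : Covector (HSpace n) ⊗[ℂ] AltForm (HSpace n) k}
    (ht : t ∈ casimirEigenspace (tensorAct (covectorBasis n).i (lieAct k (modelI n)))
      (tensorAct (covectorBasis n).j (lieAct k (modelJ n)))
      (tensorAct (covectorBasis n).k (lieAct k (modelK n))) r) :
    TensorProduct.lift wedge t ∈ modelCasimirEigenspace n (k + 1) r := by
  rw [mem_casimirEigenspace] at ht
  rw [modelCasimirEigenspace, mem_casimirEigenspace, ← map_smul, ← ht]
  simp only [casimir, LinearMap.add_apply, Module.End.mul_apply, lieAct_lift_wedge, map_add,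
    covectorBasis]

variable {n k} in
theorem wedge_mem_modelE {r : ℤ} (f : Covector (HSpace n)) {w : AltForm (HSpace n) k}
    (hw : w ∈ modelE n k r) :
    wedge f w ∈ modelE n (k + 1) (r + 1) ⊔ modelE n (k + 1) (r - 1) := by
  obtain hr | hr := lt_or_ge r 0
  · rw [modelE_of_neg n k hr, Submodule.mem_bot] at hw
    rw [hw, map_zero]
    exact zero_mem _
  rw [modelE_eq_modelCasimirEigenspace n k (by lia)] at hw
  rw [modelE_eq_modelCasimirEigenspace n (k + 1) (by lia),
    modelE_eq_modelCasimirEigenspace n (k + 1) (by lia)]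
  obtain ⟨s, hs, t, ht, hst⟩ := Submodule.mem_sup.mp
    ((isSpTriple_lieAct n k).tmul_mem_casimirEigenspace (covectorBasis n) (by lia) f hw)
  rw [← TensorProduct.lift.tmul, ← hst, map_add]
  exact Submodule.add_mem_sup (lift_wedge_mem_modelCasimirEigenspace n hs)
    (lift_wedge_mem_modelCasimirEigenspace n ht)

variable {n k} in
theorem alternatizeUncurryFin_mem_modelE {r : ℤ} {β : HSpace n →L[ℝ] AltForm (HSpace n) k}
    (hβ : ∀ v, β v ∈ modelE n k r) :
    ContinuousAlternatingMap.alternatizeUncurryFin β ∈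
      modelE n (k + 1) (r + 1) ⊔ modelE n (k + 1) (r - 1) := by
  rw [alternatizeUncurryFin_eq_sum_wedge (Module.finBasis ℝ (HSpace n))]
  exact sum_mem fun j _ => wedge_mem_modelE _ (hβ _)

theorem modelE_zero_zero : modelE n 0 0 = ⊤ := by
  refine top_le_iff.mp fun α _ => ?_
  rw [modelE_eq_modelCasimirEigenspace n 0 (by lia), modelCasimirEigenspace, mem_casimirEigenspace]
  simp [casimir, lieAct_zero_left]

theorem iSup_modelE_parity :
    ⨆ r : {r : ℤ // 0 ≤ r ∧ r ≤ k ∧ Even (k - r)}, modelE n k r = ⊤ := by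
  induction k with
  | zero =>
    exact top_le_iff.mp (le_iSup_of_le ⟨0, le_rfl, by simp, by simp⟩ (modelE_zero_zero n).ge)
  | succ k ih =>
    rw [← top_le_iff, ← map₂_wedge_top, ← ih, Submodule.map₂_iSup_right]
    refine iSup_le fun ⟨r, hr, hrk, hpar⟩ =>
      (Submodule.map₂_le.mpr fun f _ w hw => wedge_mem_modelE f hw).trans (sup_le ?_ ?_)
    · exact le_iSup_of_le ⟨r + 1, by lia, by lia, by grind⟩ le_rfl
    · obtain rfl | hr := hr.eq_or_lt
      · exact (modelE_of_neg n (k + 1) (by lia)).le.trans bot_le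
      · exact le_iSup_of_le ⟨r - 1, by lia, by lia, by grind⟩ le_rfl

theorem iSupIndep_modelE : iSupIndep (modelE n k) := by
  have hinj : Set.InjOn (fun r : ℤ => (-(r * (r + 2)) : ℂ)) (Set.Ici 0) := by
    intro r hr s hs h
    have h' : r * (r + 2) = s * (s + 2) := by exact_mod_cast neg_injective h
    have hfactor : (r - s) * (r + s + 2) = 0 := by linear_combination h'
    rcases mul_eq_zero.mp hfactor with h | h <;> grind
  intro r
  obtain hr | hr := lt_or_ge r 0
  · exact modelE_of_neg n k hr ▸ disjoint_bot_left
  rw [modelE_eq_modelCasimirEigenspace n k (by lia)]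
  refine (Module.End.eigenspaces_iSupIndep _ _).mono_right (iSup₂_le fun s hs => ?_)
  obtain hs' | hs' := lt_or_ge s 0
  · exact modelE_of_neg n k hs' ▸ bot_le
  rw [modelE_eq_modelCasimirEigenspace n k (by lia)]
  exact le_iSup₂_of_le _ (fun h => hs (hinj hs' hr h)) le_rfl

theorem iSup_modelE : ⨆ r, modelE n k r = ⊤ :=
  top_le_iff.mp (iSup_modelE_parity n k ▸ iSup_le fun r => le_iSup (modelE n k) r)

theorem modelE_eq_bot {r : ℤ} (hr : ¬(0 ≤ r ∧ r ≤ k ∧ Even (k - r))) : modelE n k r = ⊥ := by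
  by_contra hne
  refine hr ((iSupIndep_modelE n k).mem_of_biSup_eq_top
    (s := {r : ℤ | 0 ≤ r ∧ r ≤ k ∧ Even (k - r)}) ?_ hne)
  rw [← iSup_modelE_parity n k, iSup_subtype']
  rfl

end Isotypic

section Invariance

variable {n k : ℕ} {r : ℤ} {α : AltForm (HSpace n) k}

theorem pullback_apply {V W : Type*} [AddCommGroup V] [Module ℝ V] [TopologicalSpace V]
    [AddCommGroup W] [Module ℝ W] [TopologicalSpace W] (A : V →L[ℝ] W) (α : AltForm W k)
    (v : Fin k → V) : pullback A k α v = α fun i => A (v i) := rfl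

theorem pullback_lieAct {V W : Type*} [NormedAddCommGroup V] [NormedSpace ℝ V]
    [NormedAddCommGroup W] [NormedSpace ℝ W] {g : V →L[ℝ] W} {A : W →L[ℝ] W} {B : V →L[ℝ] V}
    (h : ∀ v, A (g v) = g (B v)) (α : AltForm W k) :
    pullback g k (lieAct k A α) = lieAct k B (pullback g k α) := by
  ext v
  simp only [pullback_apply, lieAct_apply, h]
  congr! with i _ j
  by_cases hj : j = i
  · subst hj; simp
  · simp [hj]

theorem leftMul_vecMul (q : ℍ[ℝ]) (v : HSpace n) (B : Matrix (Fin n) (Fin n) ℍ[ℝ]) :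
    leftMul n q (v ᵥ* B) = leftMul n q v ᵥ* B := by
  funext a
  simp [leftMul_apply, Matrix.vecMul, dotProduct, Finset.mul_sum, mul_assoc]

theorem map_mem_modelE_of_commute_casimir {f : Module.End ℂ (AltForm (HSpace n) k)}
    (hf : Commute f
      (casimir (lieAct k (modelI n)) (lieAct k (modelJ n)) (lieAct k (modelK n))))
    (hα : α ∈ modelE n k r) : f α ∈ modelE n k r := by
  obtain hr | hr := lt_or_ge r 0
  · rw [modelE_of_neg n k hr] at hα ⊢
    rw [(Submodule.mem_bot ℂ).mp hα, map_zero]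
    exact zero_mem _
  · rw [modelE_eq_modelCasimirEigenspace n k (by lia), modelCasimirEigenspace,
      mem_casimirEigenspace] at hα ⊢
    rw [← Module.End.mul_apply, ← hf.eq, Module.End.mul_apply, hα, map_smul]

theorem map_mem_modelE_of_commute {f : Module.End ℂ (AltForm (HSpace n) k)}
    (hf : ∀ q, Commute f (lieAct k (leftMul n q))) (hα : α ∈ modelE n k r) :
    f α ∈ modelE n k r :=
  map_mem_modelE_of_commute_casimir
    ((((hf quatI).mul_right (hf quatI)).add_right ((hf quatJ).mul_right (hf quatJ))).add_right
      ((hf quatK).mul_right (hf quatK))) hα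

attribute [simps] quatI quatJ quatK

theorem apply_eq_of_re_eq_zero {A : Type*} [AddCommMonoid A] [Module ℝ A] (L : ℍ[ℝ] →ₗ[ℝ] A)
    {p : ℍ[ℝ]} (hp : p.re = 0) :
    L p = p.imI • L quatI + p.imJ • L quatJ + p.imK • L quatK := by
  rw [← map_smul, ← map_smul, ← map_smul, ← map_add, ← map_add]
  congr 1
  ext <;> simp [hp]

/-- The action of quaternions on the `k`-forms of `ℍⁿ` induced by left multiplication. -/
def quatAct (n k : ℕ) : ℍ[ℝ] →ₗ[ℝ] Module.End ℂ (AltForm (HSpace n) k) :=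
  lieActHom (HSpace n) k ∘ₗ (leftMulHom n).toLinearMap

theorem quatAct_mem_modelE {p : ℍ[ℝ]} (hp : p.re = 0) (hα : α ∈ modelE n k r) :
    quatAct n k p α ∈ modelE n k r := by
  obtain ⟨hI, hJ, hK⟩ := isotypic_invariant hα
  rw [apply_eq_of_re_eq_zero (quatAct n k) hp]
  exact add_mem (add_mem ((modelE n k r).smul_of_tower_mem p.imI hI)
    ((modelE n k r).smul_of_tower_mem p.imJ hJ)) ((modelE n k r).smul_of_tower_mem p.imK hK)

theorem lieAct_mem_modelE {T : HSpace n →L[ℝ] HSpace n} (hT : MemLieSpGL n T)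
    (hα : α ∈ modelE n k r) : lieAct k T α ∈ modelE n k r := by
  obtain ⟨p, B, hp, hT⟩ := hT
  set R := T - leftMul n p with hR
  have hRapply (v : HSpace n) : R v = v ᵥ* B := by
    rw [hR, _root_.sub_apply, hT, add_sub_cancel_left]
  have hcomm (q : ℍ[ℝ]) : Commute (lieAct k R) (lieAct k (leftMul n q)) := by
    have hzero : R * leftMul n q - leftMul n q * R = 0 := by
      ext1 v
      change R (leftMul n q v) - leftMul n q (R v) = 0
      rw [hRapply, hRapply, leftMul_vecMul, sub_self]
    rw [Commute, SemiconjBy, lieAct_mul_lieAct, hzero]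
    exact (congrArg _ (map_zero (lieActHom _ k))).trans (add_zero _)
  have hsplit : lieAct k T = lieAct k R + quatAct n k p := by
    change lieActHom _ k T = lieActHom _ k R + lieActHom _ k (leftMul n p)
    rw [← map_add, sub_add_cancel]
  rw [hsplit]
  exact add_mem (map_mem_modelE_of_commute hcomm hα) (quatAct_mem_modelE hp hα)

theorem casimir_conj {A : Type*} [Ring A] [Algebra ℝ A] (L : ℍ[ℝ] →ₗ[ℝ] A) {q : ℍ[ℝ]}
    (hq : ‖q‖ = 1) :
    casimir (L (star q * quatI * q)) (L (star q * quatJ * q)) (L (star q * quatK * q)) =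
      casimir (L quatI) (L quatJ) (L quatK) := by
  have hN : q.re ^ 2 + q.imI ^ 2 + q.imJ ^ 2 + q.imK ^ 2 = 1 := by
    rw [← Quaternion.normSq_def', Quaternion.normSq_eq_norm_mul_self, hq, one_mul]
  rw [apply_eq_of_re_eq_zero L (p := star q * quatI * q) (by simp; ring),
    apply_eq_of_re_eq_zero L (p := star q * quatJ * q) (by simp; ring),
    apply_eq_of_re_eq_zero L (p := star q * quatK * q) (by simp; ring)]
  generalize L quatI = I, L quatJ = J, L quatK = K
  simp only [casimir, Quaternion.re_mul, Quaternion.imI_mul, Quaternion.imJ_mul,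
    Quaternion.imK_mul, Quaternion.re_star, Quaternion.imI_star, Quaternion.imJ_star,
    Quaternion.imK_star, re_quatI, imI_quatI, imJ_quatI, imK_quatI, re_quatJ, imI_quatJ, imJ_quatJ,
    imK_quatJ, re_quatK, imI_quatK, imJ_quatK, imK_quatK, add_mul, mul_add, smul_mul_assoc,
    mul_smul_comm]
  match_scalars <;> first
    | ring1
    | linear_combination (q.re ^ 2 + q.imI ^ 2 + q.imJ ^ 2 + q.imK ^ 2 + 1) * hN

theorem pullback_quatAct {g : HSpace n →L[ℝ] HSpace n} {q : ℍ[ℝ]} (hq : ‖q‖ = 1)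
    {A : Matrix (Fin n) (Fin n) ℍ[ℝ]} (hg : ∀ v, g v = leftMul n q (v ᵥ* A)) (p : ℍ[ℝ])
    (β : AltForm (HSpace n) k) :
    pullback g k (quatAct n k p β) = quatAct n k (star q * p * q) (pullback g k β) := by
  have hstar : q * star q = 1 := by
    rw [Quaternion.self_mul_star, Quaternion.normSq_eq_norm_mul_self, hq, one_mul,
      Quaternion.coe_one]
  refine pullback_lieAct (fun v => ?_) β
  change leftMul n p (g v) = g (leftMul n (star q * p * q) v)
  rw [hg, hg, ← leftMul_vecMul]
  funext a
  simp only [leftMul_apply, ← mul_assoc, hstar, one_mul]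

theorem commute_pullback_casimir {g : HSpace n ≃L[ℝ] HSpace n} (hg : MemSpGL n g) :
    Commute (pullback (g : HSpace n →L[ℝ] HSpace n) k : Module.End ℂ (AltForm (HSpace n) k))
      (casimir (quatAct n k quatI) (quatAct n k quatJ) (quatAct n k quatK)) := by
  obtain ⟨q, A, hq, hg⟩ := hg
  refine LinearMap.ext fun β => ?_
  have hconj := LinearMap.congr_fun
    (casimir_conj (A := Module.End ℂ (AltForm (HSpace n) k)) (quatAct n k) hq)
    (pullback (g : HSpace n →L[ℝ] HSpace n) k β)
  rw [Module.End.mul_apply, Module.End.mul_apply, ← hconj]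
  simp only [casimir, LinearMap.add_apply, Module.End.mul_apply, map_add,
    pullback_quatAct (g := (g : HSpace n →L[ℝ] HSpace n)) hq hg]

theorem pullback_mem_modelE {g : HSpace n ≃L[ℝ] HSpace n} (hg : MemSpGL n g)
    (hα : α ∈ modelE n k r) :
    pullback (g : HSpace n →L[ℝ] HSpace n) k α ∈ modelE n k r :=
  map_mem_modelE_of_commute_casimir (commute_pullback_casimir hg) hα

end Invariance

section Conj

variable {V W : Type*} [AddCommGroup V] [Module ℝ V] [TopologicalSpace V]
  [AddCommGroup W] [Module ℝ W] [TopologicalSpace W] {k : ℕ}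

/-- Complex conjugation of forms, as a conjugate-linear map. -/
def conjForm (V : Type*) [AddCommGroup V] [Module ℝ V] [TopologicalSpace V] (k : ℕ) :
    AltForm V k →ₛₗ[starRingEnd ℂ] AltForm V k where
  toFun α := (Complex.conjCLE : ℂ →L[ℝ] ℂ).compContinuousAlternatingMap α
  map_add' α β := by ext v; simp
  map_smul' c α := by ext v; simp

theorem conjForm_apply (α : AltForm V k) (v : Fin k → V) :
    conjForm V k α v = starRingEnd ℂ (α v) := rfl

theorem pullback_conjForm (A : V →L[ℝ] W) (α : AltForm W k) :
    pullback A k (conjForm W k α) = conjForm V k (pullback A k α) := rfl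

theorem conjForm_eq_self_iff (α : AltForm V k) : conjForm V k α = α ↔ ∀ v, (α v).im = 0 := by
  simp only [ContinuousAlternatingMap.ext_iff, conjForm_apply, Complex.conj_eq_iff_im]

theorem lieAct_conjForm {V : Type*} [NormedAddCommGroup V] [NormedSpace ℝ V]
    (A : V →L[ℝ] V) (α : AltForm V k) :
    lieAct k A (conjForm V k α) = conjForm V k (lieAct k A α) := by
  ext v
  simp [lieAct_apply, conjForm_apply]

theorem conjForm_mem_modelE {n : ℕ} {r : ℤ} {α : AltForm (HSpace n) k}
    (hα : α ∈ modelE n k r) : conjForm (HSpace n) k α ∈ modelE n k r := by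
  obtain hr | hr := lt_or_ge r 0
  · rw [modelE_of_neg n k hr] at hα ⊢
    rw [(Submodule.mem_bot ℂ).mp hα, map_zero]
    exact zero_mem _
  · rw [modelE_eq_modelCasimirEigenspace n k (by lia), modelCasimirEigenspace,
      mem_casimirEigenspace] at hα ⊢
    have hc : (-(r * (r + 2)) : ℂ) = starRingEnd ℂ (-(r * (r + 2))) := by
      simp only [map_neg, map_mul, map_add, Complex.conj_ofNat, map_intCast]
    rw [hc, ← map_smulₛₗ, ← hα]
    simp only [casimir, LinearMap.add_apply, Module.End.mul_apply, lieAct_conjForm, map_add]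

end Conj

section Four

/-- The real basis `1, i, j, k` of `ℍ¹`. -/
def basisFour : Module.Basis (Fin 4) ℝ (HSpace 1) :=
  Module.Basis.ofEquivFun ((LinearEquiv.funUnique (Fin 1) ℝ ℍ[ℝ]).trans
    (QuaternionAlgebra.linearEquivTuple (-1 : ℝ) 0 (-1)))

theorem basisFour_apply (i : Fin 4) (a : Fin 1) :
    basisFour i a = ![1, quatI, quatJ, quatK] i := by
  have h : basisFour i a =
      (QuaternionAlgebra.linearEquivTuple (-1 : ℝ) 0 (-1)).symm (Pi.single i 1) := by
    rw [basisFour, Module.Basis.coe_ofEquivFun]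
    rfl
  rw [h]
  fin_cases i <;> ext <;> simp

theorem modelI_basisFour_zero : modelI 1 (basisFour 0) = basisFour 1 := by
  funext a
  simp [modelI, leftMul_apply, basisFour_apply]

theorem modelI_basisFour_two : modelI 1 (basisFour 2) = basisFour 3 := by
  funext a
  simp only [modelI, leftMul_apply, basisFour_apply]
  ext <;> simp

/-- `A` kills the terms of `lieAct 3 A α v` in which it acts on `x` or `A x`, so on the remaining
argument `y` one has `α(x, A x, A y) = -3i α(x, A x, y)`, contradicting `A² = -1` unless this is
zero. -/
theorem apply_eq_zero_of_mem_weightSpace_three {V : Type*} [NormedAddCommGroup V]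
    [NormedSpace ℝ V] {A : V →L[ℝ] V} (hA : A * A = -1) {α : AltForm V 3}
    (hα : α ∈ weightSpace (lieAct 3 A) 3) {v : Fin 3 → V} {i j : Fin 3} (hij : i ≠ j)
    (hv : v j = A (v i)) : α v = 0 := by
  have hAA (x : V) : A (A x) = -x := DFunLike.congr_fun hA x
  obtain ⟨l, hli, hlj⟩ : ∃ l : Fin 3, l ≠ i ∧ l ≠ j := by clear * - i j; decide +revert
  have huniv : (Finset.univ : Finset (Fin 3)) = {i, j, l} := by
    clear * - hij hli hlj; decide +revert
  have hneg (w : Fin 3 → V) (m : Fin 3) (x : V) :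
      α (Function.update w m (-x)) = -α (Function.update w m x) :=
    α.toAlternatingMap.map_update_neg w m x
  have hstep (w : Fin 3 → V) (hw : w j = A (w i)) :
      α (Function.update w l (A (w l))) = -(3 * Complex.I) * α w := by
    have hi : α (Function.update w i (A (w i))) = 0 :=
      α.map_eq_zero_of_eq _ (by simp [hij.symm, hw]) hij
    have hj : α (Function.update w j (A (w j))) = 0 := by
      rw [hw, hAA, hneg, α.map_eq_zero_of_eq _ (by simp [hij]) hij, neg_zero]
    have := DFunLike.congr_fun (mem_weightSpace.mp hα) w
    rw [lieAct_apply, huniv, Finset.sum_insert (by simp [hij, hli.symm]),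
      Finset.sum_insert (by simpa using hlj.symm), Finset.sum_singleton, hi, hj,
      ContinuousAlternatingMap.smul_apply, smul_eq_mul] at this
    push_cast at this
    linear_combination -this
  have h := hstep (Function.update v l (A (v l))) (by simp [hli.symm, hlj.symm, hv])
  rw [Function.update_self, Function.update_idem, hAA, hneg, Function.update_eq_self,
    hstep v hv] at h
  linear_combination h / 8 + 9 / 8 * α v * Complex.I_sq

theorem modelE_one_three_three : modelE 1 3 3 = ⊥ := by
  refine le_bot_iff.mp (isotypic_le (by simp) fun α hα _ => ?_)
  refine (Submodule.mem_bot ℂ).mpr (ContinuousAlternatingMap.toAlternatingMap_injective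
    (Module.Basis.ext_alternating basisFour fun v hv => ?_))
  have hpairs : (∃ i j, v i = 0 ∧ v j = 1) ∨ ∃ i j, v i = 2 ∧ v j = 3 := by decide +revert
  have hne {i j : Fin 3} {a b : Fin 4} (hi : v i = a) (hj : v j = b) (hab : a ≠ b) : i ≠ j :=
    fun h => hab (hi ▸ hj ▸ h ▸ rfl)
  obtain ⟨i, j, hi, hj⟩ | ⟨i, j, hi, hj⟩ := hpairs
  · exact apply_eq_zero_of_mem_weightSpace_three (modelI_mul_self 1) hα (hne hi hj (by decide))
      (by rw [hi, hj, modelI_basisFour_zero])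
  · exact apply_eq_zero_of_mem_weightSpace_three (modelI_mul_self 1) hα (hne hi hj (by decide))
      (by rw [hi, hj, modelI_basisFour_two])

theorem eq_top_of_modelE_le {n k : ℕ} {U : Submodule ℂ (AltForm (HSpace n) k)}
    (hU : ∀ s : ℤ, 0 ≤ s → s ≤ k → Even (k - s) → modelE n k s ≤ U) : U = ⊤ := by
  rw [eq_top_iff, ← iSup_modelE_parity n k]
  exact iSup_le fun s => hU s s.2.1 s.2.2.1 s.2.2.2

theorem modelE_one_three_one : modelE 1 3 1 = ⊤ := by
  refine eq_top_of_modelE_le fun s h0 h1 h2 => ?_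
  obtain rfl | rfl : s = 1 ∨ s = 3 := by push_cast at h1 h2; grind
  · exact le_rfl
  · exact modelE_one_three_three.trans_le bot_le

theorem modelE_one_four_sup_eq_top : modelE 1 4 2 ⊔ modelE 1 4 0 = ⊤ := by
  rw [eq_top_iff, ← map₂_wedge_top, Submodule.map₂_le]
  exact fun f _ α _ => wedge_mem_modelE f (r := 1) (by rw [modelE_one_three_one]; trivial)

theorem subsingleton_altForm_one {k : ℕ} (hk : 4 < k) : Subsingleton (AltForm (HSpace 1) k) := by
  refine subsingleton_of_forall_eq 0 fun α => ContinuousAlternatingMap.ext fun v =>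
    α.toAlternatingMap.map_linearDependent v fun h => ?_
  have hcard := h.fintype_card_le_finrank
  rw [Module.finrank_eq_card_basis basisFour, Fintype.card_fin, Fintype.card_fin] at hcard
  lia

theorem modelE_one_sup_eq_top {k : ℕ} {r : ℤ} (hr : modelE 1 k r ≠ ⊥) :
    modelE 1 (k + 1) (r + 1) ⊔ modelE 1 (k + 1) (r - 1) = ⊤ := by
  obtain ⟨h0, hk, hpar⟩ : 0 ≤ r ∧ r ≤ k ∧ Even (k - r) := by
    by_contra h; exact hr (modelE_eq_bot 1 k h)
  obtain rfl | rfl | rfl | rfl | hk4 : k = 0 ∨ k = 1 ∨ k = 2 ∨ k = 3 ∨ 4 < k + 1 := by lia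
  · obtain rfl : r = 0 := by push_cast at hk; lia
    refine eq_top_of_modelE_le fun s _ hs hpars => ?_
    obtain rfl : s = 1 := by push_cast at hs hpars; grind
    exact le_sup_left
  · obtain rfl : r = 1 := by push_cast at hk hpar; grind
    refine eq_top_of_modelE_le fun s _ hs hpars => ?_
    obtain rfl | rfl : s = 0 ∨ s = 2 := by push_cast at hs hpars; grind
    · exact le_sup_right
    · exact le_sup_left
  · obtain rfl | rfl : r = 0 ∨ r = 2 := by push_cast at hk hpar; grind
    · exact eq_top_mono le_sup_left modelE_one_three_one
    · exact eq_top_mono le_sup_right modelE_one_three_one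
  · obtain rfl | rfl : r = 1 ∨ r = 3 := by push_cast at hk hpar; grind
    · exact modelE_one_four_sup_eq_top
    · exact absurd modelE_one_three_three hr
  · have := subsingleton_altForm_one hk4
    exact Subsingleton.elim _ _

end Four

theorem isCompl_iSup_ne {ι α : Type*} [CompleteLattice α] {f : ι → α} (hf : iSupIndep f)
    (htop : ⨆ i, f i = ⊤) (i : ι) : IsCompl (f i) (⨆ j, ⨆ (_ : j ≠ i), f j) := by
  refine ⟨hf i, codisjoint_iff.mpr (top_le_iff.mp (htop ▸ iSup_le fun j => ?_))⟩
  obtain rfl | hj := eq_or_ne j i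
  · exact le_sup_left
  · exact le_sup_of_le_right (le_iSup₂_of_le (f := fun j (_ : j ≠ i) => f j) j hj le_rfl)

/-- Pullback along a continuous linear equivalence. -/
def pullbackEquiv {V W : Type*} [AddCommGroup V] [Module ℝ V] [TopologicalSpace V]
    [AddCommGroup W] [Module ℝ W] [TopologicalSpace W] (u : V ≃L[ℝ] W) (k : ℕ) :
    AltForm W k ≃ₗ[ℂ] AltForm V k where
  __ := pullback (u : V →L[ℝ] W) k
  invFun := pullback (u.symm : W →L[ℝ] V) k
  left_inv α := by ext v; simp [pullback_apply]
  right_inv α := by ext v; simp [pullback_apply]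

/-- The projection of `Λᵏ(ℍⁿ)* ⊗ ℂ` onto `modelE n k r` along the other isotypic components. -/
def modelProj (n k : ℕ) (r : ℤ) : Module.End ℂ (AltForm (HSpace n) k) :=
  Submodule.projection _ _ (isCompl_iSup_ne (iSupIndep_modelE n k) (iSup_modelE n k) r)

section Fibre

variable {n : ℕ} {M : Type*} [TopologicalSpace M]
  [ChartedSpace (EuclideanSpace ℝ (Fin (4 * n))) M] [IsManifold (𝓡 (4 * n)) ∞ M]
  (Q : SpGLStructure n M) {k : ℕ} {x : M} {u : HSpace n ≃L[ℝ] TangentSpace (𝓡 (4 * n)) x}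
  {r s : ℤ} {α : AltForm (TangentSpace (𝓡 (4 * n)) x) k}

namespace SpGLStructure

theorem frames_nonempty (x : M) : (Q.frames x).Nonempty := by
  obtain ⟨U, -, hx, s, -, hs⟩ := Q.exists_section x
  exact ⟨s x, hs x hx⟩

theorem mem_E_iff (hu : u ∈ Q.frames x) :
    α ∈ Q.E k r x ↔
      pullback (u : HSpace n →L[ℝ] TangentSpace (𝓡 (4 * n)) x) k α ∈ modelE n k r := by
  have hle : Q.E k r x ≤ (modelE n k r).comap (pullback u.toContinuousLinearMap k) := by
    refine iSup₂_le fun w hw β hβ => ?_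
    obtain ⟨g, hg, rfl⟩ := (Q.mem_frames_iff x w hw u).mp hu
    exact pullback_mem_modelE hg (Submodule.mem_comap.mp hβ)
  exact ⟨fun h => hle h, fun h => Submodule.mem_iSup_of_mem u (Submodule.mem_iSup_of_mem hu h)⟩

theorem E_eq_map (hu : u ∈ Q.frames x) (r : ℤ) :
    Q.E k r x = Submodule.orderIsoMapComap (pullbackEquiv u k).symm (modelE n k r) := by
  ext α
  rw [Q.mem_E_iff hu, Submodule.orderIsoMapComap_apply, Submodule.mem_map_equiv]
  rfl

theorem mem_E_sup_iff (hu : u ∈ Q.frames x) :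
    α ∈ Q.E k r x ⊔ Q.E k s x ↔
      pullback (u : HSpace n →L[ℝ] TangentSpace (𝓡 (4 * n)) x) k α ∈
        modelE n k r ⊔ modelE n k s := by
  rw [Q.E_eq_map hu, Q.E_eq_map hu, ← OrderIso.map_sup, Submodule.orderIsoMapComap_apply,
    Submodule.mem_map_equiv]
  rfl

theorem iSupIndep_E (k : ℕ) (x : M) : iSupIndep fun r : ℤ => Q.E k r x := by
  obtain ⟨u, hu⟩ := Q.frames_nonempty x
  simp only [Q.E_eq_map hu]
  exact (iSupIndep_modelE n k).map_orderIso _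

theorem iSup_E (k : ℕ) (x : M) : ⨆ r : ℤ, Q.E k r x = ⊤ := by
  obtain ⟨u, hu⟩ := Q.frames_nonempty x
  simp only [Q.E_eq_map hu]
  rw [← OrderIso.map_iSup, iSup_modelE, OrderIso.map_top]

theorem isInternal_E (k : ℕ) (x : M) : DirectSum.IsInternal fun r : ℤ => Q.E k r x :=
  (DirectSum.isInternal_submodule_iff_iSupIndep_and_iSup_eq_top _).mpr
    ⟨Q.iSupIndep_E k x, Q.iSup_E k x⟩

theorem E_eq_bot (x : M) (hr : modelE n k r = ⊥) : Q.E k r x = ⊥ := by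
  obtain ⟨u, hu⟩ := Q.frames_nonempty x
  rw [Q.E_eq_map hu, hr, OrderIso.map_bot]

theorem proj_eq_projection (k : ℕ) (r : ℤ) (x : M) :
    Q.proj k r x =
      Submodule.projection _ _ (isCompl_iSup_ne (Q.iSupIndep_E k x) (Q.iSup_E k x) r) :=
  dif_pos _

theorem proj_mem (r : ℤ) (α : AltForm (TangentSpace (𝓡 (4 * n)) x) k) :
    Q.proj k r x α ∈ Q.E k r x := by
  rw [proj_eq_projection]
  exact Submodule.projection_apply_mem _ _

theorem proj_of_mem (hα : α ∈ Q.E k r x) : Q.proj k r x α = α := by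
  rw [proj_eq_projection]
  exact Submodule.projection_apply_of_mem_left _ hα

theorem proj_of_mem_ne (hsr : s ≠ r) (hα : α ∈ Q.E k s x) : Q.proj k r x α = 0 := by
  rw [proj_eq_projection]
  exact Submodule.projection_apply_of_mem_right _
    (Submodule.mem_iSup_of_mem s (Submodule.mem_iSup_of_mem hsr hα))

theorem form_induction {motive : AltForm (TangentSpace (𝓡 (4 * n)) x) k → Prop}
    (mem : ∀ r, ∀ α ∈ Q.E k r x, motive α)
    (add : ∀ α β, motive α → motive β → motive (α + β))
    (α : AltForm (TangentSpace (𝓡 (4 * n)) x) k) : motive α :=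
  Submodule.iSup_induction _ (motive := motive) (Q.iSup_E k x ▸ Submodule.mem_top : α ∈ _) mem
    (mem 0 0 (zero_mem _)) add

theorem pullback_proj (hu : u ∈ Q.frames x) (r : ℤ)
    (α : AltForm (TangentSpace (𝓡 (4 * n)) x) k) :
    pullbackEquiv u k (Q.proj k r x α) = modelProj n k r (pullbackEquiv u k α) := by
  induction α using Q.form_induction with
  | mem s β hβ =>
    have hβ' := (Q.mem_E_iff hu).mp hβ
    obtain rfl | hsr := eq_or_ne s r
    · rw [Q.proj_of_mem hβ]
      exact (Submodule.projection_apply_of_mem_left _ hβ').symm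
    · rw [Q.proj_of_mem_ne hsr hβ, map_zero]
      exact (Submodule.projection_apply_of_mem_right _
        (Submodule.mem_iSup_of_mem s (Submodule.mem_iSup_of_mem hsr hβ'))).symm
  | add β γ hβ hγ => simp only [map_add, hβ, hγ]

theorem sum_proj (α : AltForm (TangentSpace (𝓡 (4 * n)) x) k) :
    ∑ r ∈ Finset.range (k + 1), Q.proj k r x α = α := by
  induction α using Q.form_induction with
  | mem s β hβ =>
    by_cases hs : 0 ≤ s ∧ s ≤ k ∧ Even (k - s)
    · obtain ⟨m, rfl⟩ := Int.eq_ofNat_of_zero_le hs.1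
      rw [Finset.sum_eq_single m (fun r _ hr => Q.proj_of_mem_ne (by exact_mod_cast hr.symm) hβ)
        (fun h => absurd (Finset.mem_range.mpr (by lia)) h), Q.proj_of_mem hβ]
    · rw [Q.E_eq_bot x (modelE_eq_bot n k hs), Submodule.mem_bot] at hβ
      simp [hβ]
  | add β γ hβ hγ => simp only [map_add, Finset.sum_add_distrib, hβ, hγ]

theorem proj_add_proj (hrs : r ≠ s) (hα : α ∈ Q.E k r x ⊔ Q.E k s x) :
    Q.proj k r x α + Q.proj k s x α = α := by
  obtain ⟨β, hβ, γ, hγ, rfl⟩ := Submodule.mem_sup.mp hα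
  rw [map_add, map_add, Q.proj_of_mem hβ, Q.proj_of_mem hγ, Q.proj_of_mem_ne hrs hβ,
    Q.proj_of_mem_ne hrs.symm hγ, add_zero, zero_add]

theorem conjForm_mem_E (hα : α ∈ Q.E k r x) : conjForm _ k α ∈ Q.E k r x := by
  obtain ⟨u, hu⟩ := Q.frames_nonempty x
  rw [Q.mem_E_iff hu] at hα ⊢
  rw [pullback_conjForm]
  exact conjForm_mem_modelE hα

theorem proj_conjForm (r : ℤ) (α : AltForm (TangentSpace (𝓡 (4 * n)) x) k) :
    Q.proj k r x (conjForm _ k α) = conjForm _ k (Q.proj k r x α) := by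
  induction α using Q.form_induction with
  | mem s β hβ =>
    obtain rfl | hsr := eq_or_ne s r
    · rw [Q.proj_of_mem hβ, Q.proj_of_mem (Q.conjForm_mem_E hβ)]
    · rw [Q.proj_of_mem_ne hsr hβ, Q.proj_of_mem_ne hsr (Q.conjForm_mem_E hβ), map_zero]
  | add β γ hβ hγ => simp only [map_add, hβ, hγ]

end SpGLStructure

end Fibre

section Smooth

variable {X V W : Type*} [NormedAddCommGroup X] [NormedSpace ℝ X]
  [NormedAddCommGroup V] [NormedSpace ℝ V] [NormedAddCommGroup W] [NormedSpace ℝ W]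
  {k : ℕ} {m : WithTop ℕ∞} {s : Set X}

theorem contDiffOn_altForm [FiniteDimensional ℝ V] {f : X → AltForm V k}
    (hf : ∀ v, ContDiffOn ℝ m (fun y => f y v) s) : ContDiffOn ℝ m f s := by
  let b := Module.finBasis ℝ V
  let ev : AltForm V k →ₗ[ℝ] ((Fin k → Fin (Module.finrank ℝ V)) → ℂ) :=
    { toFun := fun α i => α fun j => b (i j)
      map_add' := fun _ _ => rfl
      map_smul' := fun _ _ => rfl }
  have hinj : ev.ker = ⊥ := LinearMap.ker_eq_bot.mpr fun α β h =>
    ContinuousAlternatingMap.toAlternatingMap_injective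
      (Module.Basis.ext_alternating b fun i _ => congrFun h i)
  obtain ⟨g, hg⟩ := ev.exists_leftInverse_of_injective hinj
  have hfg : f = g.toContinuousLinearMap ∘ fun y => ev (f y) :=
    funext fun y => (LinearMap.congr_fun hg (f y)).symm
  rw [hfg]
  exact g.toContinuousLinearMap.contDiff.comp_contDiffOn (contDiffOn_pi.mpr fun i => hf _)

theorem contDiffOn_pullback [FiniteDimensional ℝ V] {f : X → AltForm W k} {g : X → V →L[ℝ] W}
    (hf : ContDiffOn ℝ m f s) (hg : ContDiffOn ℝ m g s) :
    ContDiffOn ℝ m (fun y => pullback (g y) k (f y)) s := by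
  refine contDiffOn_altForm fun v => ?_
  have hf' : ContDiffOn ℝ m (fun y => (f y).toContinuousMultilinearMap) s :=
    (ContinuousAlternatingMap.toContinuousMultilinearMapCLM (𝕜 := ℝ) (E := W) (F := ℂ)
      (ι := Fin k) ℝ).contDiff.comp_contDiffOn hf
  have hg' : ContDiffOn ℝ m (fun y =>
      ContinuousMultilinearMap.compContinuousLinearMapContinuousMultilinear ℝ
        (fun _ : Fin k => V) (fun _ => W) ℂ fun _ => g y) s :=
    (ContinuousMultilinearMap.contDiff _).comp_contDiffOn (contDiffOn_pi.mpr fun _ => hg)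
  exact (ContinuousMultilinearMap.apply ℝ (fun _ : Fin k => V) ℂ v).contDiff.comp_contDiffOn
    (hg'.clm_apply hf')

theorem contDiffOn_inverse [CompleteSpace V] {g : X → V →L[ℝ] W} (hg : ContDiffOn ℝ m g s)
    (hinv : ∀ y ∈ s, (g y).IsInvertible) : ContDiffOn ℝ m (fun y => (g y).inverse) s := by
  intro y hy
  obtain ⟨e, he⟩ := hinv y hy
  exact (he ▸ contDiffAt_map_inverse e : ContDiffAt ℝ m _ (g y)).comp_contDiffWithinAt y (hg y hy)

theorem hasFDerivAt_mem_of_eventually_mem {S : Submodule ℝ V} (hS : IsClosed (S : Set V))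
    {f : X → V} {f' : X →L[ℝ] V} {y : X} (hf : HasFDerivAt f f' y)
    (hmem : ∀ᶠ z in nhds y, f z ∈ S) (v : X) : f' v ∈ S := by
  have := hS
  have hzero : S.mkQL ∘L f' = 0 :=
    (S.mkQL.hasFDerivAt.comp y hf).unique ((hasFDerivAt_const 0 y).congr_of_eventuallyEq
      (hmem.mono fun z hz => (Submodule.Quotient.mk_eq_zero S).mpr hz))
  exact (Submodule.Quotient.mk_eq_zero S).mp (DFunLike.congr_fun hzero v)

end Smooth

section MovingFrame

open ContinuousAlternatingMap

variable {V : Type*} [NormedAddCommGroup V] [NormedSpace ℝ V] {n k : ℕ}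

theorem pullback_alternatizeUncurryFin {W : Type*} [NormedAddCommGroup W] [NormedSpace ℝ W]
    (g : W →L[ℝ] V) (β : V →L[ℝ] AltForm V k) :
    pullback g (k + 1) (alternatizeUncurryFin β) =
      alternatizeUncurryFin (compContinuousLinearMapCLM g ∘L β ∘L g) := by
  ext v
  simp +unfoldPartialApp [pullback_apply, alternatizeUncurryFin_apply, Fin.removeNth,
    Function.comp_def]

theorem neg_fderivCompContinuousLinearMap_comp {W : Type*} [NormedAddCommGroup W]
    [NormedSpace ℝ W] (g : W →L[ℝ] V) (T : W →L[ℝ] W) (α : AltForm V k) :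
    -α.fderivCompContinuousLinearMap g (g ∘L T) = lieAct k T (pullback g k α) := by
  ext v
  rw [lieAct_apply, ContinuousAlternatingMap.neg_apply, fderivCompContinuousLinearMap_apply]
  refine congrArg _ (Finset.sum_congr rfl fun i _ => congrArg α (funext fun j => ?_))
  obtain rfl | hj := eq_or_ne j i
  · simp
  · simp [hj]

/-- Here `S` is a moving frame, `T` is the connection form in this frame of a connection on the
structure bundle, and `htors` says that this connection has no torsion. The proof compares the
derivative of `σ` with its covariant derivative `P`, which preserves `modelE n k r`. -/
theorem pullback_extDeriv_mem {σ : V → AltForm V k} {S : V → HSpace n →L[ℝ] V} {y : V} {r : ℤ}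
    (hσ : DifferentiableAt ℝ σ y) (hS : DifferentiableAt ℝ S y)
    (hmem : ∀ᶠ z in nhds y, pullback (S z) k (σ z) ∈ modelE n k r)
    (T : HSpace n →L[ℝ] HSpace n →L[ℝ] HSpace n) (hT : ∀ w, MemLieSpGL n (T w))
    (htors : ∀ v w, fderiv ℝ S y (S y w) v - S y (T w v) =
      fderiv ℝ S y (S y v) w - S y (T v w)) :
    pullback (S y) (k + 1) (extDeriv σ y) ∈
      modelE n (k + 1) (r + 1) ⊔ modelE n (k + 1) (r - 1) := by
  set g := S y
  let P : HSpace n →L[ℝ] AltForm (HSpace n) k :=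
    (compContinuousLinearMapCLM g ∘L fderiv ℝ σ y +
        (σ y).fderivCompContinuousLinearMap g ∘L fderiv ℝ S y) ∘L g +
      -((σ y).fderivCompContinuousLinearMap g ∘L
        (ContinuousLinearMap.compL ℝ (HSpace n) (HSpace n) V g ∘L T))
  let h : HSpace n →L[ℝ] HSpace n →L[ℝ] V :=
    fderiv ℝ S y ∘L g - ContinuousLinearMap.compL ℝ (HSpace n) (HSpace n) V g ∘L T
  have hP (w : HSpace n) : P w ∈ modelE n k r := by
    have hd := hσ.hasFDerivAt.continuousAlternatingMapCompContinuousLinearMap hS.hasFDerivAt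
    refine add_mem (hasFDerivAt_mem_of_eventually_mem
      (S := (modelE n k r).restrictScalars ℝ) (Submodule.closed_of_finiteDimensional _)
      hd hmem (g w)) ?_
    have := lieAct_mem_modelE (hT w) hmem.self_of_nhds
    rwa [← neg_fderivCompContinuousLinearMap_comp] at this
  have hsplit : P = compContinuousLinearMapCLM g ∘L fderiv ℝ σ y ∘L g +
      (σ y).fderivCompContinuousLinearMap g ∘L h := by
    ext1 w
    simp only [P, h, _root_.add_apply, _root_.sub_apply, _root_.neg_apply,
      ContinuousLinearMap.comp_apply, _root_.map_sub]
    abel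
  have hzero : alternatizeUncurryFin ((σ y).fderivCompContinuousLinearMap g ∘L h) = 0 :=
    alternatizeUncurryFin_fderivCompContinuousLinearMap_eq_zero _ _ fun v w => htors w v
  have := alternatizeUncurryFin_mem_modelE hP
  rwa [hsplit, alternatizeUncurryFin_add, hzero, add_zero,
    ← pullback_alternatizeUncurryFin] at this

end MovingFrame

section Charts

open ContinuousAlternatingMap Topology

theorem extDeriv_compContinuousAlternatingMap {V F G : Type*} [NormedAddCommGroup V]
    [NormedSpace ℝ V] [NormedAddCommGroup F] [NormedSpace ℝ F] [NormedAddCommGroup G]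
    [NormedSpace ℝ G] {k : ℕ} (L : F →L[ℝ] G) {σ : V → V [⋀^Fin k]→L[ℝ] F} {y : V}
    (hσ : DifferentiableAt ℝ σ y) :
    extDeriv (fun z => L.compContinuousAlternatingMap (σ z)) y =
      L.compContinuousAlternatingMap (extDeriv σ y) := by
  have h : fderiv ℝ (fun z => L.compContinuousAlternatingMap (σ z)) y =
      L.compContinuousAlternatingMapCLM ℝ V F G (Fin k) ∘L fderiv ℝ σ y :=
    ((L.compContinuousAlternatingMapCLM ℝ V F G (Fin k)).hasFDerivAt.comp y hσ.hasFDerivAt).fderiv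
  ext v
  simp [extDeriv, h, alternatizeUncurryFin_apply]

theorem minSmoothness_le_infty (m : ℕ) : minSmoothness ℝ m ≤ ∞ := by
  rw [minSmoothness_of_isRCLikeNormedField]
  exact WithTop.coe_le_coe.mpr (le_top : (m : ℕ∞) ≤ ⊤)

variable {n : ℕ} {M : Type*} [TopologicalSpace M]
  [ChartedSpace (EuclideanSpace ℝ (Fin (4 * n))) M] {k : ℕ} {η θ : DForm n M k} {x₀ : M}
  {y : EuclideanSpace ℝ (Fin (4 * n))}

/-- The differential at `p` of the preferred chart at `x₀`. -/
abbrev chartDeriv (x₀ p : M) :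
    TangentSpace (𝓡 (4 * n)) p →L[ℝ] EuclideanSpace ℝ (Fin (4 * n)) :=
  mfderiv (𝓡 (4 * n)) 𝓘(ℝ, EuclideanSpace ℝ (Fin (4 * n))) (extChartAt (𝓡 (4 * n)) x₀) p

/-- The differential at `y` of the inverse of the preferred chart at `x₀`. -/
abbrev chartSymmDeriv (x₀ : M) (y : EuclideanSpace ℝ (Fin (4 * n))) :
    EuclideanSpace ℝ (Fin (4 * n)) →L[ℝ]
      TangentSpace (𝓡 (4 * n)) ((extChartAt (𝓡 (4 * n)) x₀).symm y) :=
  mfderiv 𝓘(ℝ, EuclideanSpace ℝ (Fin (4 * n))) (𝓡 (4 * n)) (extChartAt (𝓡 (4 * n)) x₀).symm y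

theorem chartRep_apply (η : DForm n M k) (x₀ : M) (y : EuclideanSpace ℝ (Fin (4 * n))) :
    chartRep η x₀ y =
      pullback (chartSymmDeriv x₀ y) k (η ((extChartAt (𝓡 (4 * n)) x₀).symm y)) := rfl

theorem IsSmoothForm.differentiableAt (hη : IsSmoothForm η)
    (hy : y ∈ (extChartAt (𝓡 (4 * n)) x₀).target) : DifferentiableAt ℝ (chartRep η x₀) y :=
  ((hη x₀).contDiffAt ((isOpen_extChartAt_target x₀).mem_nhds hy)).differentiableAt (by simp)

theorem IsSmoothForm.compContinuousAlternatingMap (L : ℂ →L[ℝ] ℂ) (hη : IsSmoothForm η) :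
    IsSmoothForm fun x => L.compContinuousAlternatingMap (η x) := fun x₀ =>
  (L.compContinuousAlternatingMapCLM ℝ (EuclideanSpace ℝ (Fin (4 * n))) ℂ ℂ
    (Fin k)).contDiff.comp_contDiffOn (hη x₀)

theorem extD_compContinuousAlternatingMap (L : ℂ →L[ℝ] ℂ) (hη : IsSmoothForm η) :
    extD (fun x => L.compContinuousAlternatingMap (η x)) =
      fun x => L.compContinuousAlternatingMap (extD η x) := by
  funext x
  exact congrArg (pullback (chartDeriv x x) (k + 1))
    (extDeriv_compContinuousAlternatingMap L (hη.differentiableAt (mem_extChartAt_target x)))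

theorem extD_smul (c : ℂ) (hη : IsSmoothForm η) : extD (c • η) = c • extD η := by
  funext x
  have h : extDeriv (c • chartRep η x) (extChartAt (𝓡 (4 * n)) x x) =
      c • extDeriv (chartRep η x) (extChartAt (𝓡 (4 * n)) x x) :=
    extDeriv_compContinuousAlternatingMap (c • ContinuousLinearMap.id ℝ ℂ)
      (hη.differentiableAt (mem_extChartAt_target x))
  exact congrArg (pullback (chartDeriv x x) (k + 1)) h

theorem extD_add (hη : IsSmoothForm η) (hθ : IsSmoothForm θ) :
    extD (η + θ) = extD η + extD θ := by
  funext x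
  exact congrArg (pullback (chartDeriv x x) (k + 1))
    (extDeriv_add (hη.differentiableAt (mem_extChartAt_target x))
      (hθ.differentiableAt (mem_extChartAt_target x)))

variable [IsManifold (𝓡 (4 * n)) ∞ M]

theorem chartSymmDeriv_comp_chartDeriv (hy : y ∈ (extChartAt (𝓡 (4 * n)) x₀).target) :
    chartSymmDeriv x₀ y ∘L chartDeriv x₀ ((extChartAt (𝓡 (4 * n)) x₀).symm y) =
      ContinuousLinearMap.id ℝ _ := by
  have : IsManifold (𝓡 (4 * n)) 1 M := IsManifold.of_le (n := ∞) (by simp)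
  have h := mfderivWithin_extChartAt_symm_comp_mfderiv_extChartAt (I := 𝓡 (4 * n)) hy
  rwa [(𝓡 (4 * n)).range_eq_univ, mfderivWithin_univ] at h

theorem chartDeriv_comp_chartSymmDeriv (hy : y ∈ (extChartAt (𝓡 (4 * n)) x₀).target) :
    chartDeriv x₀ ((extChartAt (𝓡 (4 * n)) x₀).symm y) ∘L chartSymmDeriv x₀ y =
      ContinuousLinearMap.id ℝ _ := by
  have : IsManifold (𝓡 (4 * n)) 1 M := IsManifold.of_le (n := ∞) (by simp)
  have h := mfderiv_extChartAt_comp_mfderivWithin_extChartAt_symm (I := 𝓡 (4 * n)) hy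
  rwa [(𝓡 (4 * n)).range_eq_univ, mfderivWithin_univ] at h

theorem isInvertible_chartSymmDeriv (hy : y ∈ (extChartAt (𝓡 (4 * n)) x₀).target) :
    (chartSymmDeriv x₀ y).IsInvertible :=
  .of_inverse (chartSymmDeriv_comp_chartDeriv hy) (chartDeriv_comp_chartSymmDeriv hy)

theorem contMDiffAt_extChartAt_symm (hy : y ∈ (extChartAt (𝓡 (4 * n)) x₀).target) :
    ContMDiffAt 𝓘(ℝ, EuclideanSpace ℝ (Fin (4 * n))) (𝓡 (4 * n)) ∞
      (extChartAt (𝓡 (4 * n)) x₀).symm y :=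
  (contMDiffOn_extChartAt_symm x₀).contMDiffAt ((isOpen_extChartAt_target x₀).mem_nhds hy)

theorem pullback_chartRep (η : DForm n M k) {p : M}
    (hp : p ∈ (extChartAt (𝓡 (4 * n)) x₀).source) :
    pullback (chartDeriv x₀ p) k (chartRep η x₀ (extChartAt (𝓡 (4 * n)) x₀ p)) = η p := by
  obtain ⟨y, hy, rfl⟩ : ∃ y ∈ (extChartAt (𝓡 (4 * n)) x₀).target,
      (extChartAt (𝓡 (4 * n)) x₀).symm y = p :=
    ⟨_, (extChartAt (𝓡 (4 * n)) x₀).map_source hp, (extChartAt (𝓡 (4 * n)) x₀).left_inv hp⟩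
  calc
    _ = pullback (chartDeriv x₀ ((extChartAt (𝓡 (4 * n)) x₀).symm y)) k (chartRep η x₀ y) :=
      congrArg _ (congrArg _ ((extChartAt (𝓡 (4 * n)) x₀).right_inv hy))
    _ = pullback (chartSymmDeriv x₀ y ∘L
        chartDeriv x₀ ((extChartAt (𝓡 (4 * n)) x₀).symm y)) k _ := rfl
    _ = η _ := by rw [chartSymmDeriv_comp_chartDeriv hy]; rfl

theorem contDiffAt_extChartAt_comp_symm {x₁ : M}
    (hy : y ∈ (extChartAt (𝓡 (4 * n)) x₀).target)
    (hy₁ : (extChartAt (𝓡 (4 * n)) x₀).symm y ∈ (extChartAt (𝓡 (4 * n)) x₁).source) :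
    ContDiffAt ℝ ∞ (extChartAt (𝓡 (4 * n)) x₁ ∘ (extChartAt (𝓡 (4 * n)) x₀).symm) y := by
  rw [extChartAt_source] at hy₁
  exact contMDiffAt_iff_contDiffAt.mp
    ((contMDiffAt_extChartAt' hy₁).comp y (contMDiffAt_extChartAt_symm hy))

theorem fderiv_extChartAt_comp_symm {x₁ : M}
    (hy : y ∈ (extChartAt (𝓡 (4 * n)) x₀).target)
    (hy₁ : (extChartAt (𝓡 (4 * n)) x₀).symm y ∈ (extChartAt (𝓡 (4 * n)) x₁).source) :
    fderiv ℝ (extChartAt (𝓡 (4 * n)) x₁ ∘ (extChartAt (𝓡 (4 * n)) x₀).symm) y =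
      chartDeriv x₁ ((extChartAt (𝓡 (4 * n)) x₀).symm y) ∘L chartSymmDeriv x₀ y := by
  rw [extChartAt_source] at hy₁
  rw [← mfderiv_eq_fderiv]
  exact mfderiv_comp y ((contMDiffAt_extChartAt' (n := ∞) hy₁).mdifferentiableAt (by simp))
    ((contMDiffAt_extChartAt_symm hy).mdifferentiableAt (by simp))

theorem chartRep_extD (hη : IsSmoothForm η) (hy : y ∈ (extChartAt (𝓡 (4 * n)) x₀).target) :
    chartRep (extD η) x₀ y = extDeriv (chartRep η x₀) y := by
  set φ := extChartAt (𝓡 (4 * n)) x₀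
  set ψ := extChartAt (𝓡 (4 * n)) (φ.symm y)
  have hsrc : φ.symm y ∈ ψ.source := mem_extChartAt_source _
  have hev : ∀ᶠ z in 𝓝 y, z ∈ φ.target ∧ φ.symm z ∈ ψ.source :=
    ((isOpen_extChartAt_target x₀).eventually_mem hy).and
      ((continuousAt_extChartAt_symm'' hy).eventually
        ((isOpen_extChartAt_source _).eventually_mem hsrc))
  have htrans : chartRep η x₀ =ᶠ[𝓝 y] fun z => pullback (fderiv ℝ (ψ ∘ φ.symm) z) k
      (chartRep η (φ.symm y) ((ψ ∘ φ.symm) z)) := by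
    filter_upwards [hev] with z hz
    rw [fderiv_extChartAt_comp_symm hz.1 hz.2, chartRep_apply, ← pullback_chartRep η hz.2]
    rfl
  have hpull := extDeriv_pullback (f := ψ ∘ φ.symm)
    (hη.differentiableAt (mem_extChartAt_target (φ.symm y)))
    (contDiffAt_extChartAt_comp_symm hy hsrc) (minSmoothness_le_infty 2)
  rw [htrans.extDeriv_eq]
  refine Eq.trans ?_ hpull.symm
  rw [fderiv_extChartAt_comp_symm hy hsrc]
  rfl

theorem IsSmoothForm.extD (hη : IsSmoothForm η) : IsSmoothForm (extD η) := by
  intro x₀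
  refine ContDiffOn.congr ?_ fun y hy => chartRep_extD hη hy
  exact (alternatizeUncurryFinCLM ℝ (EuclideanSpace ℝ (Fin (4 * n))) ℂ).contDiff.comp_contDiffOn
    ((hη x₀).fderiv_of_isOpen (isOpen_extChartAt_target x₀) (le_refl (∞ + 1)))

theorem extD_extD (hη : IsSmoothForm η) : extD (extD η) = 0 := by
  funext x
  have h : chartRep (extD η) x =ᶠ[𝓝 (extChartAt (𝓡 (4 * n)) x x)] extDeriv (chartRep η x) := by
    filter_upwards [(isOpen_extChartAt_target x).eventually_mem (mem_extChartAt_target x)]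
      with y hy using chartRep_extD hη hy
  have hd := extDeriv_extDeriv_apply ((hη x).contDiffAt
    ((isOpen_extChartAt_target x).mem_nhds (mem_extChartAt_target x))) (minSmoothness_le_infty 2)
  exact congrArg (pullback (chartDeriv x x) (k + 2)) (h.extDeriv_eq.trans hd)

end Charts

section SmoothForms

variable (n : ℕ) (M : Type*) [TopologicalSpace M]
  [ChartedSpace (EuclideanSpace ℝ (Fin (4 * n))) M] (k : ℕ)

/-- The space of smooth complex-valued `k`-forms on `M`. -/
def smoothForms : Submodule ℂ (DForm n M k) where
  carrier := {η | IsSmoothForm η}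
  add_mem' hη hθ x₀ := (hη x₀).add (hθ x₀)
  zero_mem' _ := contDiffOn_const (c := (0 : AltForm (EuclideanSpace ℝ (Fin (4 * n))) k))
  smul_mem' c _ hη x₀ := (hη x₀).const_smul c

/-- Complex conjugation of smooth forms, as a conjugate-linear map. -/
def smoothConj : smoothForms n M k →ₛₗ[starRingEnd ℂ] smoothForms n M k where
  toFun η := ⟨fun x => conjForm _ k (η.1 x), η.2.compContinuousAlternatingMap Complex.conjCLE⟩
  map_add' η θ := Subtype.ext (funext fun x => map_add (conjForm _ k) (η.1 x) (θ.1 x))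
  map_smul' c η := Subtype.ext (funext fun x => map_smulₛₗ (conjForm _ k) c (η.1 x))

/-- The exterior derivative of smooth forms, as a linear map. -/
def smoothExtD [IsManifold (𝓡 (4 * n)) ∞ M] :
    smoothForms n M k →ₗ[ℂ] smoothForms n M (k + 1) where
  toFun η := ⟨extD η.1, η.2.extD⟩
  map_add' η θ := Subtype.ext (extD_add η.2 θ.2)
  map_smul' c η := Subtype.ext (extD_smul c η.2)

variable {n M k}

theorem smoothConj_eq_self_iff (η : smoothForms n M k) :
    smoothConj n M k η = η ↔ IsRealForm η.1 := by
  simp only [Subtype.ext_iff, funext_iff, IsRealForm, ← conjForm_eq_self_iff]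
  rfl

theorem smoothExtD_smoothConj [IsManifold (𝓡 (4 * n)) ∞ M] (η : smoothForms n M k) :
    smoothExtD n M k (smoothConj n M k η) = smoothConj n M (k + 1) (smoothExtD n M k η) :=
  Subtype.ext (extD_compContinuousAlternatingMap Complex.conjCLE η.2)

theorem smoothExtD_comp_smoothExtD [IsManifold (𝓡 (4 * n)) ∞ M] :
    smoothExtD n M (k + 1) ∘ₗ smoothExtD n M k = 0 :=
  LinearMap.ext fun η => Subtype.ext (extD_extD η.2)

end SmoothForms

section ChartFrame

open Topology VectorField

variable {n : ℕ} {M : Type*} [TopologicalSpace M]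
  [ChartedSpace (EuclideanSpace ℝ (Fin (4 * n))) M] {k : ℕ}
  {s : ∀ x : M, HSpace n ≃L[ℝ] TangentSpace (𝓡 (4 * n)) x} {U : Set M} {x₀ : M}
  {y : EuclideanSpace ℝ (Fin (4 * n))}

/-- The expression of a frame field in the preferred chart at `x₀`. -/
def chartFrame (s : ∀ x : M, HSpace n ≃L[ℝ] TangentSpace (𝓡 (4 * n)) x) (x₀ : M)
    (y : EuclideanSpace ℝ (Fin (4 * n))) : HSpace n →L[ℝ] EuclideanSpace ℝ (Fin (4 * n)) :=
  (chartSymmDeriv x₀ y).inverse ∘L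
    (s ((extChartAt (𝓡 (4 * n)) x₀).symm y) : HSpace n →L[ℝ] TangentSpace (𝓡 (4 * n)) _)

theorem isOpen_target_inter_preimage (x₀ : M) (hU : IsOpen U) :
    IsOpen ((extChartAt (𝓡 (4 * n)) x₀).target ∩ (extChartAt (𝓡 (4 * n)) x₀).symm ⁻¹' U) :=
  (continuousOn_extChartAt_symm x₀).isOpen_inter_preimage (isOpen_extChartAt_target x₀) hU

variable [IsManifold (𝓡 (4 * n)) ∞ M]

theorem chartSymmDeriv_comp_chartFrame (s : ∀ x : M, HSpace n ≃L[ℝ] TangentSpace (𝓡 (4 * n)) x)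
    (hy : y ∈ (extChartAt (𝓡 (4 * n)) x₀).target) :
    chartSymmDeriv x₀ y ∘L chartFrame s x₀ y =
      (s ((extChartAt (𝓡 (4 * n)) x₀).symm y) : HSpace n →L[ℝ] TangentSpace (𝓡 (4 * n)) _) := by
  obtain ⟨e, he⟩ := isInvertible_chartSymmDeriv hy
  rw [chartFrame, ← he, ContinuousLinearMap.inverse_equiv]
  ext v
  exact e.apply_symm_apply _

theorem isInvertible_chartFrame (s : ∀ x : M, HSpace n ≃L[ℝ] TangentSpace (𝓡 (4 * n)) x)
    (hy : y ∈ (extChartAt (𝓡 (4 * n)) x₀).target) : (chartFrame s x₀ y).IsInvertible :=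
  (isInvertible_chartSymmDeriv hy).inverse.comp ⟨s _, rfl⟩

theorem pullback_chartFrame (s : ∀ x : M, HSpace n ≃L[ℝ] TangentSpace (𝓡 (4 * n)) x)
    (hy : y ∈ (extChartAt (𝓡 (4 * n)) x₀).target) (η : DForm n M k) :
    pullback (chartFrame s x₀ y) k (chartRep η x₀ y) =
      pullback (s ((extChartAt (𝓡 (4 * n)) x₀).symm y) : HSpace n →L[ℝ] _) k
        (η ((extChartAt (𝓡 (4 * n)) x₀).symm y)) := by
  rw [← chartSymmDeriv_comp_chartFrame s hy]
  rfl

theorem contDiffOn_chartFrame (x₀ : M) (hU : IsOpen U) (hs : SmoothFrameOn s U) :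
    ContDiffOn ℝ ∞ (chartFrame s x₀)
      ((extChartAt (𝓡 (4 * n)) x₀).target ∩ (extChartAt (𝓡 (4 * n)) x₀).symm ⁻¹' U) := by
  have : IsManifold (𝓡 (4 * n)) (∞ + 1) M := inferInstanceAs (IsManifold (𝓡 (4 * n)) ∞ M)
  refine contDiffOn_clm_apply.mpr fun v y hy => ContDiffAt.contDiffWithinAt ?_
  refine contMDiffAt_vectorSpace_iff_contDiffAt.mp ?_
  exact ContMDiffAt.mpullback_vectorField_preimage (V := fun x => s x v) (n := ∞)
    ((hs v).contMDiffAt (hU.mem_nhds hy.2)) (contMDiffAt_extChartAt_symm hy.1)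
    (isInvertible_chartSymmDeriv hy.1) (le_refl (∞ + 1))

namespace SpGLStructure

variable (Q : SpGLStructure n M) {r : ℤ} {η : DForm n M k}

theorem chartRep_proj (r : ℤ) (η : DForm n M k) (hy : y ∈ (extChartAt (𝓡 (4 * n)) x₀).target)
    (hs : s ((extChartAt (𝓡 (4 * n)) x₀).symm y) ∈ Q.frames _) :
    chartRep (fun x => Q.proj k r x (η x)) x₀ y =
      pullback (chartFrame s x₀ y).inverse k
        (modelProj n k r (pullback (chartFrame s x₀ y) k (chartRep η x₀ y))) := by
  obtain ⟨e, he⟩ := isInvertible_chartFrame s hy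
  have h : pullbackEquiv e k (chartRep (fun x => Q.proj k r x (η x)) x₀ y) =
      modelProj n k r (pullback (chartFrame s x₀ y) k (chartRep η x₀ y)) := by
    rw [pullback_chartFrame s hy]
    refine Eq.trans ?_ (Q.pullback_proj hs r (η _))
    exact (congrArg (fun A => pullback A k _) he).trans (pullback_chartFrame s hy _)
  rw [← h, ← he, ContinuousLinearMap.inverse_equiv]
  exact ((pullbackEquiv e k).symm_apply_apply _).symm

theorem isSmoothForm_proj (r : ℤ) (hη : IsSmoothForm η) :
    IsSmoothForm fun x => Q.proj k r x (η x) := by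
  intro x₀ y hy
  obtain ⟨U, hU, hyU, s, hs, hsQ⟩ := Q.exists_section ((extChartAt (𝓡 (4 * n)) x₀).symm y)
  have hframe := contDiffOn_chartFrame x₀ hU hs
  have hsmooth := contDiffOn_pullback
    ((LinearMap.toContinuousLinearMap
      ((modelProj n k r).restrictScalars ℝ)).contDiff.comp_contDiffOn
        (contDiffOn_pullback ((hη x₀).mono Set.inter_subset_left) hframe))
    (contDiffOn_inverse hframe fun z hz => isInvertible_chartFrame s hz.1)
  exact ((hsmooth.congr fun z hz => Q.chartRep_proj r η hz.1 (hsQ _ hz.2)).contDiffAt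
    ((isOpen_target_inter_preimage x₀ hU).mem_nhds ⟨hy, hyU⟩)).contDiffWithinAt

end SpGLStructure

end ChartFrame

section TorsionFree

open VectorField

variable {n : ℕ} {M : Type*} [TopologicalSpace M]
  [ChartedSpace (EuclideanSpace ℝ (Fin (4 * n))) M] [IsManifold (𝓡 (4 * n)) ∞ M]
  {s : ∀ x : M, HSpace n ≃L[ℝ] TangentSpace (𝓡 (4 * n)) x} {U : Set M} {k : ℕ} {x x₀ : M}
  {y : EuclideanSpace ℝ (Fin (4 * n))}
  {cov : CovariantDerivative (𝓡 (4 * n)) (EuclideanSpace ℝ (Fin (4 * n)))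
    (TangentSpace (𝓡 (4 * n)) : M → Type _)}

theorem SmoothFrameOn.mdifferentiableAt (hs : SmoothFrameOn s U) (hU : IsOpen U) (hx : x ∈ U)
    (v : HSpace n) : MDifferentiableAt (𝓡 (4 * n)) (𝓡 (4 * n)).tangent
      (fun x => (⟨x, s x v⟩ : TangentBundle (𝓡 (4 * n)) M)) x :=
  ((hs v).contMDiffAt (hU.mem_nhds hx)).mdifferentiableAt (by simp)

theorem chartFrame_mlieBracket (hU : IsOpen U) (hs : SmoothFrameOn s U)
    (hy : y ∈ (extChartAt (𝓡 (4 * n)) x₀).target)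
    (hyU : (extChartAt (𝓡 (4 * n)) x₀).symm y ∈ U) (v w : HSpace n) :
    (chartSymmDeriv x₀ y).inverse (mlieBracket (𝓡 (4 * n)) (fun x => s x v) (fun x => s x w)
      ((extChartAt (𝓡 (4 * n)) x₀).symm y)) =
    fderiv ℝ (chartFrame s x₀) y (chartFrame s x₀ y v) w -
      fderiv ℝ (chartFrame s x₀) y (chartFrame s x₀ y w) v := by
  have : IsManifold (𝓡 (4 * n)) (minSmoothness ℝ 3) M := .of_le (minSmoothness_le_infty 3)
  have hframe : DifferentiableAt ℝ (chartFrame s x₀) y :=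
    ((contDiffOn_chartFrame x₀ hU hs).contDiffAt
      ((isOpen_target_inter_preimage x₀ hU).mem_nhds ⟨hy, hyU⟩)).differentiableAt (by simp)
  have hfderiv (v : HSpace n) (u : EuclideanSpace ℝ (Fin (4 * n))) :
      fderiv ℝ (fun z => chartFrame s x₀ z v) y u = fderiv ℝ (chartFrame s x₀) y u v := by
    simp [fderiv_clm_apply hframe (differentiableAt_const v)]
  have hflat (X Y : ∀ z, TangentSpace 𝓘(ℝ, EuclideanSpace ℝ (Fin (4 * n))) z) :
      mlieBracket 𝓘(ℝ, EuclideanSpace ℝ (Fin (4 * n))) X Y y = lieBracket ℝ X Y y := by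
    rw [← mlieBracketWithin_univ, mlieBracketWithin_eq_lieBracketWithin]
    exact congrFun lieBracketWithin_univ y
  have hpull := mpullback_mlieBracket (I := 𝓘(ℝ, EuclideanSpace ℝ (Fin (4 * n))))
    (f := (extChartAt (𝓡 (4 * n)) x₀).symm) (n := ∞) (hs.mdifferentiableAt hU hyU v)
    (hs.mdifferentiableAt hU hyU w) (contMDiffAt_extChartAt_symm hy) (minSmoothness_le_infty 2)
  rw [mpullback_apply] at hpull
  rw [← hfderiv, ← hfderiv]
  exact hpull.trans (hflat _ _)

namespace SpGLStructure

variable (Q : SpGLStructure n M)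

/-- Some connection on `Q`, not required to be smooth, has no torsion. -/
def HasTorsionFreeConnection : Prop :=
  ∃ cov : CovariantDerivative (𝓡 (4 * n)) (EuclideanSpace ℝ (Fin (4 * n)))
    (TangentSpace (𝓡 (4 * n)) : M → Type _), cov.torsion = 0 ∧ Q.IsCompatible cov

variable {Q}

theorem IsCompatible.exists_connectionForm (hcov : Q.IsCompatible cov) (hU : IsOpen U)
    (hs : SmoothFrameOn s U) (hsQ : ∀ x ∈ U, s x ∈ Q.frames x) (hx : x ∈ U) :
    ∃ T : HSpace n →L[ℝ] HSpace n →L[ℝ] HSpace n, (∀ w, MemLieSpGL n (T w)) ∧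
      ∀ v w, cov (fun z => s z v) x (s x w) = s x (T w v) := by
  choose T hT hTs using fun w => hcov U s hU hs hsQ x hx (s x w)
  refine ⟨LinearMap.toContinuousLinearMap
    { toFun := T
      map_add' := fun w w' => ?_
      map_smul' := fun c w => ?_ }, hT, fun v w => hTs w v⟩
  · ext1 v
    apply (s x).injective
    rw [← hTs, map_add, map_add, _root_.add_apply, map_add, ← hTs, ← hTs]
  · ext1 v
    apply (s x).injective
    rw [← hTs, map_smul, map_smul, _root_.smul_apply, map_smul, ← hTs]
    rfl

theorem HasTorsionFreeConnection.extD_mem (hQ : Q.HasTorsionFreeConnection) {r : ℤ}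
    {η : DForm n M k} (hη : Q.IsSmoothSection k r η)
    (hy : y ∈ (extChartAt (𝓡 (4 * n)) x₀).target) :
    extD η ((extChartAt (𝓡 (4 * n)) x₀).symm y) ∈
      Q.E (k + 1) (r + 1) _ ⊔ Q.E (k + 1) (r - 1) _ := by
  obtain ⟨cov, htor, hcov⟩ := hQ
  obtain ⟨U, hU, hyU, s, hs, hsQ⟩ := Q.exists_section ((extChartAt (𝓡 (4 * n)) x₀).symm y)
  obtain ⟨T, hT, hTs⟩ := hcov.exists_connectionForm hU hs hsQ hyU
  have hO := (isOpen_target_inter_preimage x₀ hU).mem_nhds ⟨hy, hyU⟩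
  have hbracket (v w : HSpace n) :
      mlieBracket (𝓡 (4 * n)) (fun x => s x v) (fun x => s x w)
        ((extChartAt (𝓡 (4 * n)) x₀).symm y) = s _ (T v w - T w v) := by
    have h := cov.torsion_apply (hs.mdifferentiableAt hU hyU v) (hs.mdifferentiableAt hU hyU w)
    rw [htor, hTs, hTs] at h
    rw [map_sub]
    exact (sub_eq_zero.mp h.symm).symm
  rw [Q.mem_E_sup_iff (hsQ _ hyU), ← pullback_chartFrame s hy, chartRep_extD hη.1 hy]
  refine pullback_extDeriv_mem (hη.1.differentiableAt hy)
    (((contDiffOn_chartFrame x₀ hU hs).contDiffAt hO).differentiableAt (by simp)) ?_ T hT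
    fun v w => ?_
  · filter_upwards [hO] with z hz
    rw [pullback_chartFrame s hz.1]
    exact (Q.mem_E_iff (hsQ _ hz.2)).mp (hη.2 _)
  · have h : chartFrame s x₀ y (T v w - T w v) = _ :=
      (congrArg _ (hbracket v w)).symm.trans (chartFrame_mlieBracket hU hs hy hyU v w)
    rw [map_sub] at h
    linear_combination (norm := abel) h

end SpGLStructure

end TorsionFree

section DoubleComplex

open Finset

variable {n : ℕ} {M : Type*} [TopologicalSpace M]
  [ChartedSpace (EuclideanSpace ℝ (Fin (4 * n))) M] [IsManifold (𝓡 (4 * n)) ∞ M] {k : ℕ}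

namespace SpGLStructure

variable (Q : SpGLStructure n M)

/-- The space `C^∞(E_{k,r})` of smooth sections of `E_{k,r}`. -/
def smoothSections (k : ℕ) (r : ℤ) : Submodule ℂ (smoothForms n M k) where
  carrier := {η | ∀ x, η.1 x ∈ Q.E k r x}
  add_mem' hη hθ x := add_mem (hη x) (hθ x)
  zero_mem' _ := zero_mem _
  smul_mem' c _ hη x := Submodule.smul_mem _ c (hη x)

/-- The projection `π_{k,r}`, as a linear map on smooth forms. -/
def component (k : ℕ) (r : ℤ) : smoothForms n M k →ₗ[ℂ] smoothForms n M k where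
  toFun η := ⟨fun x => Q.proj k r x (η.1 x), Q.isSmoothForm_proj r η.2⟩
  map_add' η θ := Subtype.ext (funext fun x => map_add (Q.proj k r x) (η.1 x) (θ.1 x))
  map_smul' c η := Subtype.ext (funext fun x => map_smul (Q.proj k r x) c (η.1 x))

/-- The part of the exterior derivative which shifts the weight by `e`: it is `𝒟` for `e = 1` and
`𝒟̄` for `e = -1`. -/
def weightShift (k : ℕ) (e : ℤ) : smoothForms n M k →ₗ[ℂ] smoothForms n M (k + 1) :=
  ∑ r ∈ range (k + 1), Q.component (k + 1) (r + e) ∘ₗ smoothExtD n M k ∘ₗ Q.component k r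

variable {Q} {r s t : ℤ} {η : smoothForms n M k}

theorem component_mem (r : ℤ) (η : smoothForms n M k) :
    Q.component k r η ∈ Q.smoothSections k r :=
  fun x => Q.proj_mem r (η.1 x)

theorem component_of_mem (hη : η ∈ Q.smoothSections k r) : Q.component k r η = η :=
  Subtype.ext (funext fun x => Q.proj_of_mem (hη x))

theorem component_of_mem_ne (hsr : s ≠ r) (hη : η ∈ Q.smoothSections k s) :
    Q.component k r η = 0 :=
  Subtype.ext (funext fun x => Q.proj_of_mem_ne hsr (hη x))

theorem sum_component (η : smoothForms n M k) :
    ∑ r ∈ range (k + 1), Q.component k r η = η := by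
  ext1
  funext x
  rw [Submodule.coe_sum, Finset.sum_apply]
  exact Q.sum_proj (η.1 x)

theorem component_smoothConj (r : ℤ) (η : smoothForms n M k) :
    Q.component k r (smoothConj n M k η) = smoothConj n M k (Q.component k r η) :=
  Subtype.ext (funext fun x => Q.proj_conjForm r (η.1 x))

theorem smoothSections_eq_bot (hr : modelE n k r = ⊥) : Q.smoothSections k r = ⊥ := by
  refine (Submodule.eq_bot_iff _).mpr fun η hη => Subtype.ext (funext fun x => ?_)
  exact (Submodule.mem_bot ℂ).mp (Q.E_eq_bot x hr ▸ hη x)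

theorem hom_ext {N : Type*} [AddCommMonoid N] [Module ℂ N] {f g : smoothForms n M k →ₗ[ℂ] N}
    (h : ∀ r, ∀ η ∈ Q.smoothSections k r, f η = g η) : f = g := by
  ext1 η
  rw [← Q.sum_component η, map_sum, map_sum]
  exact sum_congr rfl fun r _ => h r _ (component_mem r η)

theorem eq_zero_of_add_add_eq_zero (hrs : r ≠ s) (hst : s ≠ t) (htr : t ≠ r)
    {α β γ : smoothForms n M k} (hα : α ∈ Q.smoothSections k r) (hβ : β ∈ Q.smoothSections k s)
    (hγ : γ ∈ Q.smoothSections k t) (h : α + β + γ = 0) : α = 0 ∧ β = 0 ∧ γ = 0 := by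
  have hα0 : α = 0 := by
    simpa [component_of_mem hα, component_of_mem_ne hrs.symm hβ, component_of_mem_ne htr hγ]
      using congrArg (Q.component k r) h
  have hβ0 : β = 0 := by
    simpa [component_of_mem hβ, component_of_mem_ne hrs hα, component_of_mem_ne hst.symm hγ]
      using congrArg (Q.component k s) h
  exact ⟨hα0, hβ0, by simpa [hα0, hβ0] using h⟩

theorem weightShift_smoothConj (e : ℤ) (η : smoothForms n M k) :
    Q.weightShift k e (smoothConj n M k η) = smoothConj n M (k + 1) (Q.weightShift k e η) := by
  simp only [weightShift, LinearMap.sum_apply, map_sum, LinearMap.comp_apply,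
    component_smoothConj, smoothExtD_smoothConj]

theorem isRealForm_weightShift (e : ℤ) (hη : IsRealForm η.1) :
    IsRealForm (Q.weightShift k e η).1 := by
  rw [← smoothConj_eq_self_iff] at hη ⊢
  rw [← weightShift_smoothConj, hη]

theorem weightShift_of_mem (e : ℤ) (hη : η ∈ Q.smoothSections k r) :
    Q.weightShift k e η = Q.component (k + 1) (r + e) (smoothExtD n M k η) := by
  by_cases hr : 0 ≤ r ∧ r ≤ k ∧ Even (k - r)
  · obtain ⟨m, rfl⟩ := Int.eq_ofNat_of_zero_le hr.1
    rw [weightShift, LinearMap.sum_apply, sum_eq_single m]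
    · simp only [LinearMap.comp_apply, component_of_mem hη]
    · intro s _ hs
      simp only [LinearMap.comp_apply, component_of_mem_ne (Nat.cast_injective.ne hs.symm) hη,
        map_zero]
    · exact fun h => absurd (mem_range.mpr (by lia)) h
  · rw [smoothSections_eq_bot (modelE_eq_bot n k hr), Submodule.mem_bot] at hη
    simp only [hη, map_zero]

theorem weightShift_mem (e : ℤ) (hη : η ∈ Q.smoothSections k r) :
    Q.weightShift k e η ∈ Q.smoothSections (k + 1) (r + e) := by
  rw [weightShift_of_mem e hη]
  exact component_mem _ _

theorem smoothExtD_mem_sup (hn : 1 ≤ n) (hQ : 2 ≤ n → Q.HasTorsionFreeConnection)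
    (hη : η ∈ Q.smoothSections k r) (x : M) :
    (smoothExtD n M k η).1 x ∈ Q.E (k + 1) (r + 1) x ⊔ Q.E (k + 1) (r - 1) x := by
  rcases hn.eq_or_lt with rfl | hn
  · by_cases hr : modelE 1 k r = ⊥
    · rw [smoothSections_eq_bot hr, Submodule.mem_bot] at hη
      rw [hη, map_zero]
      exact zero_mem _
    · obtain ⟨u, hu⟩ := Q.frames_nonempty x
      rw [Q.mem_E_sup_iff hu, modelE_one_sup_eq_top hr]
      exact Submodule.mem_top
  · have h := (hQ hn).extD_mem ⟨η.2, hη⟩ (mem_extChartAt_target (I := 𝓡 (4 * n)) x)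
    rwa [extChartAt_to_inv] at h

theorem smoothExtD_eq_add (hn : 1 ≤ n) (hQ : 2 ≤ n → Q.HasTorsionFreeConnection) :
    smoothExtD n M k = Q.weightShift k 1 + Q.weightShift k (-1) := by
  refine Q.hom_ext fun r η hη => ?_
  ext1
  funext x
  rw [LinearMap.add_apply, weightShift_of_mem 1 hη, weightShift_of_mem (-1) hη]
  exact (Q.proj_add_proj (by lia) (smoothExtD_mem_sup hn hQ hη x)).symm

theorem weightShift_relations (hn : 1 ≤ n) (hQ : 2 ≤ n → Q.HasTorsionFreeConnection)
    (hη : η ∈ Q.smoothSections k r) :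
    Q.weightShift (k + 1) 1 (Q.weightShift k 1 η) = 0 ∧
      Q.weightShift (k + 1) 1 (Q.weightShift k (-1) η) +
        Q.weightShift (k + 1) (-1) (Q.weightShift k 1 η) = 0 ∧
      Q.weightShift (k + 1) (-1) (Q.weightShift k (-1) η) = 0 := by
  have hul := weightShift_mem 1 (weightShift_mem (-1) hη)
  have hlu := weightShift_mem (-1) (weightShift_mem 1 hη)
  rw [neg_add_cancel_right] at hul
  rw [add_neg_cancel_right] at hlu
  refine eq_zero_of_add_add_eq_zero (by lia) (by lia) (by lia)
    (weightShift_mem 1 (weightShift_mem 1 hη)) (add_mem hul hlu)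
    (weightShift_mem (-1) (weightShift_mem (-1) hη)) ?_
  have hd := LinearMap.congr_fun (smoothExtD_comp_smoothExtD (n := n) (M := M) (k := k)) η
  simp only [smoothExtD_eq_add hn hQ, LinearMap.comp_apply, LinearMap.add_apply, map_add,
    LinearMap.zero_apply] at hd
  rw [← hd]
  abel

theorem weightShift_comp_weightShift (hn : 1 ≤ n) (hQ : 2 ≤ n → Q.HasTorsionFreeConnection) :
    Q.weightShift (k + 1) 1 ∘ₗ Q.weightShift k 1 = 0 ∧
      Q.weightShift (k + 1) 1 ∘ₗ Q.weightShift k (-1) +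
        Q.weightShift (k + 1) (-1) ∘ₗ Q.weightShift k 1 = 0 ∧
      Q.weightShift (k + 1) (-1) ∘ₗ Q.weightShift k (-1) = 0 := by
  refine ⟨Q.hom_ext fun r η hη => ?_, Q.hom_ext fun r η hη => ?_, Q.hom_ext fun r η hη => ?_⟩
  · exact (weightShift_relations hn hQ hη).1
  · exact (weightShift_relations hn hQ hη).2.1
  · exact (weightShift_relations hn hQ hη).2.2

variable (Q)

theorem D_coe (η : smoothForms n M k) : Q.D η.1 = (Q.weightShift k 1 η).1 := by
  rw [weightShift, LinearMap.sum_apply, Submodule.coe_sum]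
  rfl

theorem Dbar_coe (η : smoothForms n M k) : Q.Dbar η.1 = (Q.weightShift k (-1) η).1 := by
  rw [weightShift, LinearMap.sum_apply, Submodule.coe_sum]
  rfl

theorem upper_coe (hη : η ∈ Q.smoothSections k r) :
    Q.upper k r η.1 = (Q.weightShift k 1 η).1 :=
  (congrArg Subtype.val (weightShift_of_mem 1 hη)).symm

theorem lower_coe (hη : η ∈ Q.smoothSections k r) :
    Q.lower k r η.1 = (Q.weightShift k (-1) η).1 :=
  (congrArg Subtype.val (weightShift_of_mem (-1) hη)).symm

theorem extD_coe (hn : 1 ≤ n) (hQ : 2 ≤ n → Q.HasTorsionFreeConnection)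
    (η : smoothForms n M k) :
    extD η.1 = (Q.weightShift k 1 η).1 + (Q.weightShift k (-1) η).1 :=
  congrArg Subtype.val (LinearMap.congr_fun (smoothExtD_eq_add hn hQ) η)

end SpGLStructure

end DoubleComplex

end QuatDolbeault

end

open QuatDolbeault in
theorem proposition4p5_general (n : ℕ) (hn : 1 ≤ n) (M : Type*) [TopologicalSpace M]
    [ChartedSpace (EuclideanSpace ℝ (Fin (4 * n))) M] [IsManifold (𝓡 (4 * n)) ∞ M]
    (Q : SpGLStructure n M) (hQ : 2 ≤ n → Q.HasTorsionFreeConnection) :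
    (∀ (k : ℕ) (x : M), DirectSum.IsInternal fun r : ℤ => Q.E k r x) ∧
    (∀ (k : ℕ) (r : ℤ) (η : DForm n M k), Q.IsSmoothSection k r η →
      Q.IsSmoothSection (k + 1) (r + 1) (Q.upper k r η) ∧
      Q.IsSmoothSection (k + 1) (r - 1) (Q.lower k r η) ∧
      extD η = Q.upper k r η + Q.lower k r η ∧
      Q.D η = Q.upper k r η ∧ Q.Dbar η = Q.lower k r η) ∧
    (∀ (k : ℕ) (η : DForm n M k), IsSmoothForm η →
      IsSmoothForm (Q.D η) ∧ IsSmoothForm (Q.Dbar η) ∧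
      extD η = Q.D η + Q.Dbar η ∧
      Q.D (Q.D η) = 0 ∧ Q.D (Q.Dbar η) + Q.Dbar (Q.D η) = 0 ∧ Q.Dbar (Q.Dbar η) = 0) ∧
    (∀ (k : ℕ) (a b : ℂ) (η θ : DForm n M k), IsSmoothForm η → IsSmoothForm θ →
      Q.D (a • η + b • θ) = a • Q.D η + b • Q.D θ ∧
      Q.Dbar (a • η + b • θ) = a • Q.Dbar η + b • Q.Dbar θ) ∧
    (∀ (k : ℕ) (η : DForm n M k), IsSmoothForm η → IsRealForm η →
      IsRealForm (Q.D η) ∧ IsRealForm (Q.Dbar η)) := by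
  refine ⟨fun k x => Q.isInternal_E k x, fun k r η hη => ?_, fun k η hη => ?_,
    fun k a b η θ hη hθ => ?_, fun k η hη hreal => ?_⟩
  · obtain ⟨η, hηr, rfl⟩ : ∃ ξ ∈ Q.smoothSections k r, ξ.1 = η := ⟨⟨η, hη.1⟩, hη.2, rfl⟩
    rw [Q.upper_coe hηr, Q.lower_coe hηr]
    exact ⟨⟨Subtype.prop _, Q.weightShift_mem 1 hηr⟩, ⟨Subtype.prop _, Q.weightShift_mem (-1) hηr⟩,
      Q.extD_coe hn hQ η, Q.D_coe η, Q.Dbar_coe η⟩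
  · lift η to smoothForms n M k using hη
    obtain ⟨huu, hul, hll⟩ := Q.weightShift_comp_weightShift (k := k) hn hQ
    simp only [Q.D_coe, Q.Dbar_coe]
    exact ⟨Subtype.prop _, Subtype.prop _, Q.extD_coe hn hQ η,
      congrArg Subtype.val (LinearMap.congr_fun huu η),
      congrArg Subtype.val (LinearMap.congr_fun hul η),
      congrArg Subtype.val (LinearMap.congr_fun hll η)⟩
  · lift η to smoothForms n M k using hη
    lift θ to smoothForms n M k using hθ
    simp only [← Submodule.coe_smul, ← Submodule.coe_add, Q.D_coe, Q.Dbar_coe, map_add, map_smul,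
      and_self]
  · lift η to smoothForms n M k using hη
    rw [Q.D_coe, Q.Dbar_coe]
    exact ⟨Q.isRealForm_weightShift 1 hreal, Q.isRealForm_weightShift (-1) hreal⟩

open QuatDolbeault in
/-- On a quaternionic manifold, `d = 𝒟 + 𝒟̄` and `𝒟² = 𝒟𝒟̄ + 𝒟̄𝒟 = 𝒟̄² = 0`. For `n = 1` no
condition beyond the `Sp(1)GL(1,ℍ)`-structure (an oriented conformal structure) is imposed, so that
self-dual conformal 4-manifolds are covered. -/
theorem proposition4p5 (n : ℕ) (hn : 1 ≤ n) (M : Type*) [TopologicalSpace M] [T2Space M]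
    [SecondCountableTopology M] [ChartedSpace (EuclideanSpace ℝ (Fin (4 * n))) M]
    [IsManifold (𝓡 (4 * n)) ∞ M] (Q : SpGLStructure n M)
    (hQ : 2 ≤ n → Q.AdmitsTorsionFreeConnection) :
    -- the decomposition of forms which defines the projections
    (∀ (k : ℕ) (x : M), DirectSum.IsInternal fun r : ℤ => Q.E k r x) ∧
    -- on sections of `E_{k,r}` the operators are the components of `d` of higher and lower weight
    (∀ (k : ℕ) (r : ℤ) (η : DForm n M k), Q.IsSmoothSection k r η →
      Q.IsSmoothSection (k + 1) (r + 1) (Q.upper k r η) ∧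
      Q.IsSmoothSection (k + 1) (r - 1) (Q.lower k r η) ∧
      extD η = Q.upper k r η + Q.lower k r η ∧
      Q.D η = Q.upper k r η ∧ Q.Dbar η = Q.lower k r η) ∧
    -- the identities on all smooth forms
    (∀ (k : ℕ) (η : DForm n M k), IsSmoothForm η →
      IsSmoothForm (Q.D η) ∧ IsSmoothForm (Q.Dbar η) ∧
      extD η = Q.D η + Q.Dbar η ∧
      Q.D (Q.D η) = 0 ∧ Q.D (Q.Dbar η) + Q.Dbar (Q.D η) = 0 ∧ Q.Dbar (Q.Dbar η) = 0) ∧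
    -- the operators are linear
    (∀ (k : ℕ) (a b : ℂ) (η θ : DForm n M k), IsSmoothForm η → IsSmoothForm θ →
      Q.D (a • η + b • θ) = a • Q.D η + b • Q.D θ ∧
      Q.Dbar (a • η + b • θ) = a • Q.Dbar η + b • Q.Dbar θ) ∧
    -- the operators preserve real forms
    (∀ (k : ℕ) (η : DForm n M k), IsSmoothForm η → IsRealForm η →
      IsRealForm (Q.D η) ∧ IsRealForm (Q.Dbar η)) :=
  proposition4p5_general n hn M Q fun h =>
    let ⟨cov, _, htor, hcov⟩ := hQ h
    ⟨cov, htor, hcov⟩
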